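/- Definitions. A $\mathrm{MOD}_m$-circuit in variables $x_1,\dots,x_n$ is a finite directed acyclic multigraph of gates with a designated root; its gates without incoming wires (input gates) are labelled with variables, each variable labelling exactly one of them, and every other gate is labelled with an operation $\mathrm{MOD}_m^R$ ($R\subseteq\mathbb{Z}_m$), which outputs $1$ if the sum of its inputs (counted with wire multiplicity) modulo $m$ lies in $R$, and $0$ otherwise. The circuit computes the Boolean function given by the value at its root. Its size $|C|$ is the number of gates plus the number of wires (with multiplicity), and its depth is the maximal number of wires on a path between the root and an input gate; a $\mathrm{CC}_d[m]$-circuit is a $\mathrm{MOD}_m$-circuit of depth $d$. For $\Gamma\le\mathbf{Sym}_n$, a circuit is $\Gamma$-symmetric if for every $\pi\in\Gamma$ there is a permutation of its gates that maps the input gate of $x_i$ to that of $x_{\pi(i)}$ for all $i$ and preserves the operations of the internal gates and all wire multiplicities. For positive integers $k_1,\dots,k_h$ with product $n$, let $\mathcal{T}_n^{\boldsymbol k}$ be the rooted tree with levels $0,\dots,h$ (root on level $h$) in which every node on level $i\ge 1$ has $k_i$ children; its $n$ leaves (level $0$) are identified with $x_1,\dots,x_n$ by an arbitrary fixed bijection,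 and $\mathbf{Aut}(\mathcal{T}_n^{\boldsymbol k})$ is viewed as a subgroup of $\mathbf{Sym}_n$ through its action on the leaves. Theorem. Let $m$ be a positive integer with exactly $r\ge 2$ distinct prime divisors, and let $h\in\mathbb{N}$. There are constants $c,c'>0$, depending only on $m$ and $h$, such that the following holds. Let $N\subseteq\mathbb{N}$ be a set (typically infinite) and let $\boldsymbol k=(k_1(n),\dots,k_h(n))$ be a tuple of functions of $n$ with $\prod_{i=1}^h k_i(n)=n$ for all $n\in N$, and with $k_i(n)>8$ for every $i\in\{1,\dots,h\}$ and all sufficiently large $n\in N$. Put $k_{\max}(n)=\max_i k_i(n)$. Then for all sufficiently large $n\in N$: (1) every $\mathbf{Aut}(\mathcal{T}_n^{\boldsymbol k})$-symmetric $\mathrm{MOD}_m$-circuit $C$ that computes the Boolean function $\mathrm{AND}_n$ has size $|C|\ge 2^{\,c\,k_{\max}(n)^{1/r}\log_2 k_{\max}(n)}$; (2) there is an $\mathbf{Aut}(\mathcal{T}_n^{\boldsymbol k})$-symmetric $\mathrm{CC}_{2h}[m]$-circuit $C$, whose root is its only gate without outgoing wires, that computes $\mathrm{AND}_n$ and has size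 $|C|\le 2^{\,c'\,k_{\max}(n)^{1/r}\log_2 k_{\max}(n)}$. -/

import Mathlib

open Filter

/-! ### Modular counting circuits -/

/-- A `MOD_m`-circuit over the variables `x_1, …, x_n` (indexed by `Fin n`): a finite directed
acyclic multigraph of gates with a designated root. `wires g g'` is the multiplicity of the wire
that feeds the value of `g` into `g'`. A gate is labelled either with a variable (`Sum.inl i`) or
with the operation `MOD_m^R` for some `R ⊆ ℤ_m` (`Sum.inr R`). The gates without incoming wires are
exactly those labelled with variables, and each variable labels exactly one gate. -/
structure ModCircuit (m n : ℕ) where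
  Gate : Type
  gateFintype : Fintype Gate
  label : Gate → Fin n ⊕ Set (ZMod m)
  wires : Gate → Gate → ℕ
  root : Gate
  acyclic : WellFounded fun g g' : Gate => 0 < wires g g'
  source_iff_input : ∀ g', (∀ g, wires g g' = 0) ↔ ∃ i, label g' = Sum.inl i
  existsUnique_input : ∀ i, ∃! g, label g = Sum.inl i

attribute [instance] ModCircuit.gateFintype

namespace ModCircuit

variable {m n : ℕ}

open Classical in
/-- The Boolean value computed by a gate under the assignment `x`: an input gate has the value of
its variable, and a gate `MOD_m^R` has the value `1` iff the sum of the values of its incoming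
wires, counted with multiplicity and taken modulo `m`, lies in `R`. -/
noncomputable def eval (C : ModCircuit m n) (x : Fin n → Bool) : C.Gate → Bool :=
  C.acyclic.fix fun g' value =>
    match C.label g' with
    | Sum.inl i => x i
    | Sum.inr R =>
      decide
        (((∑ g, if w : 0 < C.wires g g' then C.wires g g' * (value g w).toNat else 0 : ℕ) : ZMod m)
          ∈ R)

/-- The circuit computes the Boolean function `AND_n` (at its root). -/
def ComputesAnd (C : ModCircuit m n) : Prop :=
  ∀ x : Fin n → Bool, C.eval x C.root = true ↔ ∀ i, x i = true

/-- The size of a circuit: number of gates plus number of wires, counted with multiplicity. -/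
def size (C : ModCircuit m n) : ℕ :=
  Fintype.card C.Gate + ∑ g, ∑ g', C.wires g g'

/-- The maximal number of wires on a path from an input gate to the given gate. -/
noncomputable def height (C : ModCircuit m n) : C.Gate → ℕ :=
  C.acyclic.fix fun g' height =>
    Finset.univ.sup fun g => if w : 0 < C.wires g g' then height g w + 1 else 0

/-- The depth of a circuit: the maximal number of wires on a path between the root and an
input gate. -/
noncomputable def depth (C : ModCircuit m n) : ℕ :=
  C.height C.root

/-- The root is the only gate whose value is not fed into another gate. -/
def RootIsOnlySink (C : ModCircuit m n) : Prop :=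
  ∀ g, (∀ g', C.wires g g' = 0) ↔ g = C.root

/-- The permutation `σ` of the gates is a circuit automorphism that permutes the input gates as `π`
permutes the variables: it maps the input gate of `x_i` to that of `x_{π(i)}` and preserves the
operations of the internal gates and the multiplicities of all wires. -/
def IsAutExtending (C : ModCircuit m n) (π : Equiv.Perm (Fin n)) (σ : Equiv.Perm C.Gate) : Prop :=
  (∀ g i, C.label g = Sum.inl i → C.label (σ g) = Sum.inl (π i)) ∧
  (∀ g R, C.label g = Sum.inr R → C.label (σ g) = Sum.inr R) ∧
  ∀ g g', C.wires (σ g) (σ g') = C.wires g g'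

/-- `C` is `Γ`-symmetric: every `π ∈ Γ` extends to an automorphism of `C`. -/
def IsSymmetric (C : ModCircuit m n) (Γ : Subgroup (Equiv.Perm (Fin n))) : Prop :=
  ∀ π ∈ Γ, ∃ σ : Equiv.Perm C.Gate, C.IsAutExtending π σ

end ModCircuit

/-! ### The rooted tree with block sizes `k` and its automorphisms -/

/-- The nodes of the rooted tree with levels `0, …, h` in which every node on level `i + 1` has
`k i` children (`i : Fin h`). A node on level `j` is given by the choices of a child made on the way
down from the root (level `h`): one element of `Fin (k i)` for each step from level `i + 1` to level
`i`, for `i = h - 1, …, j`. -/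
structure TreeNode {h : ℕ} (k : Fin h → ℕ) where
  level : ℕ
  level_le : level ≤ h
  path : (i : Fin h) → level ≤ i → Fin (k i)

/-- The edges of the tree, directed away from the root: `v` is a child of `u`. -/
def TreeNode.HasChild {h : ℕ} {k : Fin h → ℕ} (u v : TreeNode k) : Prop :=
  ∃ huv : u.level = v.level + 1,
    ∀ (i : Fin h) (hi : u.level ≤ i), u.path i hi = v.path i (by omega)

/-- The leaves of the tree. -/
def TreeLeaf {h : ℕ} (k : Fin h → ℕ) : Type :=
  {v : TreeNode k // v.level = 0}

/-- The automorphism group of the tree (permutations of the nodes that preserve edges and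
non-edges), regarded as a permutation group on `Fin n` through its action on the leaves, which are
identified with `Fin n` via `e`. -/
def treeAut {h n : ℕ} (k : Fin h → ℕ) (e : TreeLeaf k ≃ Fin n) : Subgroup (Equiv.Perm (Fin n)) where
  carrier := {π | ∃ φ : (TreeNode.HasChild (k := k)) ≃r (TreeNode.HasChild (k := k)),
    ∀ i, φ (e.symm i).1 = (e.symm (π i)).1}
  one_mem' := ⟨RelIso.refl _, fun _ => rfl⟩
  mul_mem' := by
    rintro π π' ⟨φ, hφ⟩ ⟨φ', hφ'⟩
    exact ⟨φ'.trans φ, fun i => by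
      simp only [RelIso.trans_apply, hφ', hφ, Equiv.Perm.mul_apply]⟩
  inv_mem' := by
    rintro π ⟨φ, hφ⟩
    refine ⟨φ.symm, fun i => ?_⟩
    have hi := hφ (π⁻¹ i)
    rw [← Equiv.Perm.mul_apply, mul_inv_cancel, Equiv.Perm.one_apply] at hi
    rw [← hi]
    exact φ.symm_apply_apply _

/-- The largest block size `k_max` of the tree. -/
def maxBlock {h : ℕ} (k : Fin h → ℕ) : ℕ :=
  Finset.univ.sup k

/-! Lower bound. On a level `i₀` with the largest block size, the symmetric group on `Ω = Fin (k
i₀)` acts on the leaves by permuting one coordinate of all paths at once. The stabilizer of a gate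
has index at most the number of gates. If that number is below `(2 * v).factorial` and `Ω` is large
compared with `v`, every gate stabilizer contains the alternating group on all but fewer than `4 *
v` points (`exists_card_compl_class_lt`, `map_alternatingGroup_le`). Inside the large part for the
root, fix a copy `E` of the alternating group on `ZMod (2 * M)`, where `M` is a product of prime
powers, one for each prime divisor `p` of `m`. It contains a translation of `p`-power order for each
such `p`. The gates feeding an `E`-stable gate split into orbits under a lift of this translation.
Orbits of length divisible by the full power of `p` in `m` contribute zero modulo that power, and a
gate on a shorter orbit is stabilized by a permutation with such long cycles that its stabilizer
must contain all of `E` (`rel_of_long_orbit`). By induction, `E`-stable gates cannot tell the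
all-true input from the one that is false exactly on the blocks moved by `E`
(`eval_eq_of_le_gateStabilizer`), so the root does not compute the conjunction. Since `M ≤ m * (4 *
v) ^ r`, `v` may be of order `kmax ^ (1 / r)`.

Upper bound. Each inner node tests in depth two whether its number `w` of false children is `0`. As
`w ≤ kmax`, it suffices to test `p ^ e ∣ w` for all `p ∣ m`, where the powers are of order `kmax ^
(1 / r)` and have product above `kmax`. Modulo `p`, the indicator of `p ^ e ∣ w` is the binomial
coefficient of `w + p ^ e - 1` over `p ^ e - 1` (Lucas), and Vandermonde expands it into indicators
that all children in a set `S` with `S.card < p ^ e` are false. Each of those is an average of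
indicators of linear forms modulo another prime `q ∣ m`, with `q` invertible modulo `p`
(`dvd_sum_formCoeff_iff`). The weights `m / p` merge the conditions for all `p` into one sum modulo
`m` (`sum_div_mul_eq_zero_iff`). The construction is canonical, hence symmetric. -/

/-! ### Subgroups of small index in symmetric groups -/

section SmallIndex

open Equiv

variable {α β : Type*} [DecidableEq α] [DecidableEq β]

/-- The three-cycle `i ↦ j ↦ k ↦ i`. -/
def threeCycle (i j k : α) : Perm α := swap i j * swap j k

theorem conj_threeCycle (g : Perm α) (i j k : α) :
    g * threeCycle i j k * g⁻¹ = threeCycle (g i) (g j) (g k) := by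
  have h (a b : α) : g * swap a b * g⁻¹ = swap (g a) (g b) := by
    rw [mul_swap_eq_swap_mul]; simp
  calc g * threeCycle i j k * g⁻¹ = (g * swap i j * g⁻¹) * (g * swap j k * g⁻¹) := by
        unfold threeCycle; group
    _ = _ := by rw [h, h]; rfl

theorem threeCycle_apply {i j k : α} (hij : i ≠ j) (hik : i ≠ k) (hjk : j ≠ k) :
    threeCycle i j k i = j ∧ threeCycle i j k j = k ∧ threeCycle i j k k = i := by
  simp only [threeCycle, Perm.mul_apply]
  refine ⟨?_, ?_, ?_⟩
  · rw [swap_apply_of_ne_of_ne hij hik, swap_apply_left]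
  · rw [swap_apply_left, swap_apply_of_ne_of_ne hik.symm hjk.symm]
  · rw [swap_apply_right, swap_apply_right]

theorem threeCycle_apply_of_ne {i j k x : α} (hi : x ≠ i) (hj : x ≠ j) (hk : x ≠ k) :
    threeCycle i j k x = x := by
  simp only [threeCycle, Perm.mul_apply]
  rw [swap_apply_of_ne_of_ne hj hk, swap_apply_of_ne_of_ne hi hj]

theorem threeCycle_inv (i j k : α) : (threeCycle i j k)⁻¹ = threeCycle k j i := by
  simp [threeCycle, swap_comm]

theorem threeCycle_rotate {i j k : α} (hij : i ≠ j) (hik : i ≠ k) (hjk : j ≠ k) :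
    threeCycle i j k = threeCycle j k i := by
  obtain ⟨h1, h2, h3⟩ := threeCycle_apply hij hik hjk
  obtain ⟨h4, h5, h6⟩ := threeCycle_apply hjk hij.symm hik.symm
  ext x
  by_cases hi : x = i
  · rw [hi, h1, h6]
  by_cases hj : x = j
  · rw [hj, h2, h4]
  by_cases hk : x = k
  · rw [hk, h3, h5]
  rw [threeCycle_apply_of_ne hi hj hk, threeCycle_apply_of_ne hj hk hi]

/-- `i` and `j` agree, or some three-cycle of `H` maps `i` to `j`. -/
def ThreeCycleRel (H : Subgroup (Perm α)) (i j : α) : Prop :=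
  i = j ∨ i ≠ j ∧ ∃ k, i ≠ k ∧ j ≠ k ∧ threeCycle i j k ∈ H

namespace ThreeCycleRel

variable {H : Subgroup (Perm α)} {i j k : α}

theorem symm (h : ThreeCycleRel H i j) : ThreeCycleRel H j i := by
  rcases h with rfl | ⟨hij, k, hik, hjk, h⟩
  · exact Or.inl rfl
  · refine Or.inr ⟨hij.symm, k, hjk, hik, ?_⟩
    rw [← threeCycle_rotate hjk.symm hik.symm hij.symm, ← threeCycle_inv]
    exact H.inv_mem h

theorem map {g : Perm α} (hg : g ∈ H) (h : ThreeCycleRel H i j) :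
    ThreeCycleRel H (g i) (g j) := by
  rcases h with rfl | ⟨hij, k, hik, hjk, h⟩
  · exact Or.inl rfl
  · refine Or.inr ⟨g.injective.ne hij, g k, g.injective.ne hik, g.injective.ne hjk, ?_⟩
    rw [← conj_threeCycle]
    exact H.mul_mem (H.mul_mem hg h) (H.inv_mem hg)

/-- A three-cycle taking `j` to `l` either fixes `i`, and then transports the relation from `i, j`
to `i, l`, or contains `i` and `l` itself. -/
theorem trans {l : α} (h : ThreeCycleRel H i j) (h' : ThreeCycleRel H j l) :
    ThreeCycleRel H i l := by
  rcases h' with rfl | ⟨hjl, a, hja, hla, h'⟩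
  · exact h
  by_cases hij : i = j
  · subst hij
    exact Or.inr ⟨hjl, a, hja, hla, h'⟩
  by_cases hil : i = l
  · exact Or.inl hil
  by_cases hia : i = a
  · subst hia
    rw [threeCycle_rotate hjl hja hla] at h'
    exact symm (Or.inr ⟨Ne.symm hil, j, hjl.symm, hij, h'⟩)
  have := h.map h'
  rwa [threeCycle_apply_of_ne hij hil hia, (threeCycle_apply hjl hja hla).1] at this

/-- Some three-cycle of `H` starts with `i, j`, say with third point `a`, and by transitivity
another one takes `a` to `k`. Conjugating the first by the second replaces `a` by `k`; if the second
one also moves `i` or `j`, conjugation by its inverse gives the inverse of the desired cycle. -/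
theorem threeCycle_mem (hij : i ≠ j) (hik : i ≠ k) (hjk : j ≠ k) (h : ThreeCycleRel H i j)
    (h' : ThreeCycleRel H j k) : threeCycle i j k ∈ H := by
  rcases h with h | ⟨-, a, hia, hja, h⟩
  · exact absurd h hij
  by_cases hka : k = a
  · rwa [hka]
  have hak : ThreeCycleRel H a k := by
    refine trans ?_ h'
    rw [threeCycle_rotate hij hia hja] at h
    exact symm (Or.inr ⟨hja, i, hij.symm, hia.symm, h⟩)
  rcases hak with hak | ⟨-, b, hab, hkb, hg⟩
  · exact absurd hak.symm hka
  by_cases hbi : b = i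
  · subst hbi
    have h1 := H.mul_mem (H.mul_mem (H.inv_mem hg) h) (H.inv_mem (H.inv_mem hg))
    rw [conj_threeCycle, threeCycle_inv] at h1
    obtain ⟨e1, e2, e3⟩ := threeCycle_apply hkb.symm hab.symm hka
    rw [e1, e3, threeCycle_apply_of_ne hij.symm hjk hja] at h1
    have h2 := H.inv_mem h1
    rwa [threeCycle_inv] at h2
  by_cases hbj : b = j
  · subst hbj
    have h1 := H.mul_mem (H.mul_mem (H.inv_mem hg) h) (H.inv_mem (H.inv_mem hg))
    rw [conj_threeCycle, threeCycle_inv] at h1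
    obtain ⟨e1, e2, e3⟩ := threeCycle_apply hkb.symm hab.symm hka
    rw [e1, e3, threeCycle_apply_of_ne hij hik hia] at h1
    have h2 := H.inv_mem h1
    rwa [threeCycle_inv, ← threeCycle_rotate hij hik hjk] at h2
  have h1 := H.mul_mem (H.mul_mem hg h) (H.inv_mem hg)
  rw [conj_threeCycle, (threeCycle_apply (Ne.symm hka) hab hkb).1,
    threeCycle_apply_of_ne hia hik (Ne.symm hbi),
    threeCycle_apply_of_ne hja hjk (Ne.symm hbj)] at h1
  exact h1

end ThreeCycleRel

/-- Two permutations whose supports meet in a single point have a three-cycle as commutator. -/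
theorem commutator_eq_threeCycle {x y : Perm α} {a : α} (hx : x a ≠ a)
    (hxy : ∀ b, x b ≠ b → y b ≠ b → b = a) :
    x * y * x⁻¹ * y⁻¹ = threeCycle a (x a) (y a) := by
  have hyx : y (x a) = x a := by
    by_contra h
    exact hx (hxy _ (x.injective.ne hx) h)
  -- On the support of `y` the permutation `x` acts like the transposition of `a` and `x a`, so both
  -- conjugate `y` to the same permutation.
  have h1 : x * y * x⁻¹ = swap a (x a) * y * (swap a (x a))⁻¹ := by
    have key : ∀ b, y b ≠ b → x b = swap a (x a) b := by
      intro b hb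
      by_cases hba : b = a
      · rw [hba, swap_apply_left]
      · rw [swap_apply_of_ne_of_ne hba (fun h => hb (by rw [h, hyx]))]
        by_contra h
        exact hba (hxy b h hb)
    have h2 : (swap a (x a))⁻¹ * x * y = y * ((swap a (x a))⁻¹ * x) := by
      ext b
      simp only [Perm.mul_apply]
      by_cases hb : y b = b
      · rw [hb]
        by_contra h
        have h' : y (((swap a (x a))⁻¹) (x b)) ≠ ((swap a (x a))⁻¹) (x b) := fun e => h e.symm
        have := key _ h'
        rw [Perm.inv_def, Equiv.apply_symm_apply] at this
        have hbb := x.injective this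
        rw [Perm.inv_def, hbb, hb] at h'
        exact h' rfl
      · rw [key b hb, key (y b) (y.injective.ne hb), Perm.inv_def, Equiv.symm_apply_apply, Equiv.symm_apply_apply]
    calc x * y * x⁻¹ = swap a (x a) * ((swap a (x a))⁻¹ * x * y) * x⁻¹ := by group
      _ = _ := by rw [h2]; group
  calc x * y * x⁻¹ * y⁻¹ = swap a (x a) * (y * (swap a (x a)) * y⁻¹) := by
        rw [h1, swap_inv]; group
    _ = swap a (x a) * swap (x a) (y a) := by
        rw [mul_swap_eq_swap_mul, mul_inv_cancel_right, hyx, swap_comm (y a)]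

section Index

variable [Fintype α] {H : Subgroup (Perm α)}

/-- The permutations supported on `S` lie in pairwise different cosets of `H`. -/
theorem factorial_card_le_index {S : Finset α}
    (h : ∀ g ∈ H, (∀ a, a ∉ S → g a = a) → g = 1) : (S.card).factorial ≤ H.index := by
  classical
  have hinj : Function.Injective
      (fun π : Perm S => (QuotientGroup.mk (Perm.ofSubtype π) : Perm α ⧸ H)) := by
    intro π π' hπ
    have h1 := QuotientGroup.eq.1 hπ
    rw [← map_inv, ← map_mul] at h1
    have h2 := h _ h1 (fun a ha => Perm.ofSubtype_apply_of_not_mem _ ha)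
    rw [← map_one (Perm.ofSubtype (p := fun a => a ∈ S))] at h2
    exact (inv_mul_eq_one.1 (Perm.ofSubtype_injective h2))
  have := Nat.card_le_card_of_injective _ hinj
  rwa [Nat.card_eq_fintype_card, Fintype.card_perm, Fintype.card_coe] at this

/-- A subgroup of `Perm α` without three-cycles inside `T` has large index (Bochert). -/
theorem factorial_le_index_of_no_threeCycle {T : Finset α}
    (hT : ∀ i ∈ T, ∀ j ∈ T, ∀ k ∈ T, i ≠ j → i ≠ k → j ≠ k → threeCycle i j k ∉ H) :
    ((T.card + 1) / 2).factorial ≤ H.index := by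
  classical
  -- Take `D` minimal such that only the identity of `H` is supported on `T \ D`. If `D` were more
  -- than half of `T`, minimality would give a nontrivial `x` in `H` supported on `D`, and a
  -- nontrivial `y` in `H` supported on `T \ D` together with a point `a` moved by `x`. Their
  -- supports meet only in `a`, so their commutator would be a forbidden three-cycle.
  let P : Finset α → Prop := fun D => ∀ g ∈ H, (∀ a, a ∉ T \ D → g a = a) → g = 1
  have hex : ∃ n, ∃ D, D ⊆ T ∧ P D ∧ D.card = n :=
    ⟨_, T, subset_rfl, fun g _ h => by ext a; simpa using h a (by simp), rfl⟩
  obtain ⟨D, hDT, hPD, hcard⟩ := Nat.find_spec hex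
  have hmin : ∀ D', D' ⊆ T → P D' → D.card ≤ D'.card := fun D' h1 h2 => by
    rw [hcard]; exact Nat.find_min' hex ⟨D', h1, h2, rfl⟩
  have hle : D.card ≤ (T \ D).card := by
    by_contra hlt
    have hn : ¬ P (T \ D) := fun h => hlt (hmin _ Finset.sdiff_subset h)
    simp only [P, not_forall, sdiff_sdiff_right_self, Finset.inf_eq_inter,
      Finset.inter_eq_right.2 hDT] at hn
    obtain ⟨x, hxH, hxD, hx1⟩ := hn
    obtain ⟨a, ha⟩ : ∃ a, x a ≠ a := by
      by_contra hc
      push Not at hc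
      exact hx1 (by ext a; simpa using hc a)
    have haD : a ∈ D := by
      by_contra h
      exact ha (hxD a h)
    have hn' : ¬ P (D.erase a) := fun h => by
      have := hmin _ ((Finset.erase_subset _ _).trans hDT) h
      have := Finset.card_erase_lt_of_mem haD
      omega
    simp only [P, not_forall] at hn'
    obtain ⟨y, hyH, hyD, hy1⟩ := hn'
    have hya : y a ≠ a := by
      intro hya
      refine hy1 (hPD y hyH fun b hb => ?_)
      by_cases hba : b = a
      · rw [hba, hya]
      · exact hyD b (by simp only [Finset.mem_sdiff, Finset.mem_erase] at hb ⊢; tauto)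
    have hxy : ∀ b, x b ≠ b → y b ≠ b → b = a := by
      intro b hb hb'
      by_contra hba
      refine hb' (hyD b ?_)
      have : b ∈ D := by
        by_contra h
        exact hb (hxD b h)
      simp only [Finset.mem_sdiff, Finset.mem_erase]
      tauto
    have hxa : x a ∈ D := by
      by_contra h
      exact x.injective.ne ha (hxD _ h)
    have hyT : y a ∈ T := by
      by_contra h
      exact y.injective.ne hya (hyD _ (by simp [h]))
    refine hT a (hDT haD) (x a) (hDT hxa) (y a) hyT ha.symm hya.symm ?_ ?_
    · intro h
      have h1 : y (x a) ≠ x a := by rw [h]; exact y.injective.ne hya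
      exact ha (hxy _ (x.injective.ne ha) h1)
    · rw [← commutator_eq_threeCycle ha hxy]
      exact H.mul_mem (H.mul_mem (H.mul_mem hxH hyH) (H.inv_mem hxH)) (H.inv_mem hyH)
  refine le_trans (Nat.factorial_le ?_) (factorial_card_le_index (S := T \ D) hPD)
  have := Finset.card_sdiff_add_card_eq_card hDT
  omega

end Index

end SmallIndex

/-! ### Small index forces one dominant class of points -/

section SmallIndex

open Equiv

theorem Nat.choose_le_choose_of_le_half {n a b : ℕ} (hab : a ≤ b) (hb : b ≤ n / 2) :
    n.choose a ≤ n.choose b := by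
  induction b, hab using Nat.le_induction with
  | base => exact le_rfl
  | succ b hab ih =>
    exact (ih (by omega)).trans (Nat.choose_le_succ_of_lt_half_left (by omega))

theorem Nat.choose_le_choose_of_le_of_add_le {n a b : ℕ} (hab : a ≤ b) (hb : a + b ≤ n) :
    n.choose a ≤ n.choose b := by
  by_cases h : b ≤ n / 2
  · exact Nat.choose_le_choose_of_le_half hab h
  · rw [← Nat.choose_symm (show b ≤ n by omega)]
    exact Nat.choose_le_choose_of_le_half (by omega) (by omega)

/-- The numerical contradiction behind the dominant class: the binomial coefficient is at least `(4
* v - 1) ^ (4 * v)`, and each half of this power beats one of the two factors on the left. -/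
theorem factorial_mul_lt_choose {v n : ℕ} (hv : 1 ≤ v) (hn : (4 * v) ^ 2 ≤ n) :
    (2 * v).factorial * (4 * v) < n.choose (4 * v) := by
  have hb : (4 * v - 1) * (4 * v) ≤ n + 1 - 4 * v := by
    obtain ⟨w, rfl⟩ : ∃ w, v = w + 1 := ⟨v - 1, by omega⟩
    have : 4 * (w + 1) - 1 = 4 * w + 3 := by omega
    rw [this]
    have : (4 * w + 3) * (4 * (w + 1)) + 4 * (w + 1) ≤ n := by nlinarith
    omega
  have h2 : (n + 1 - 4 * v) ^ (4 * v) ≤ n.choose (4 * v) * (4 * v).factorial := by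
    have h := Nat.pow_sub_le_descFactorial n (4 * v)
    rw [Nat.descFactorial_eq_factorial_mul_choose] at h
    rwa [mul_comm (4 * v).factorial] at h
  have h3 : ((4 * v - 1) ^ (4 * v)) * (4 * v).factorial ≤ n.choose (4 * v) * (4 * v).factorial := by
    refine le_trans ?_ h2
    refine le_trans ?_ (Nat.pow_le_pow_left hb _)
    rw [mul_pow]
    exact Nat.mul_le_mul_left _ (Nat.factorial_le_pow _)
  have h4 := Nat.le_of_mul_le_mul_right h3 (Nat.factorial_pos _)
  refine lt_of_lt_of_le ?_ h4
  have h5 : (2 * v).factorial ≤ (4 * v - 1) ^ (2 * v) :=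
    (Nat.factorial_le_pow _).trans (Nat.pow_le_pow_left (by omega) _)
  have h6 : 4 * v < (4 * v - 1) ^ (2 * v) := by
    calc 4 * v < (4 * v - 1) ^ 2 := by
          obtain ⟨w, rfl⟩ : ∃ w, v = w + 1 := ⟨v - 1, by omega⟩
          have : 4 * (w + 1) - 1 = 4 * w + 3 := by omega
          rw [this]; nlinarith
      _ ≤ _ := Nat.pow_le_pow_right (by omega) (by omega)
  calc (2 * v).factorial * (4 * v) < (4 * v - 1) ^ (2 * v) * (4 * v - 1) ^ (2 * v) :=
        Nat.mul_lt_mul_of_le_of_lt h5 h6 (Nat.pow_pos (by omega))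
    _ = (4 * v - 1) ^ (4 * v) := by rw [← pow_add]; congr 1; omega

variable {α β : Type*} [DecidableEq α] [DecidableEq β]

/-- The equivalence relation of lying on a common three-cycle of `H`. -/
def threeCycleSetoid (H : Subgroup (Perm α)) : Setoid α where
  r := ThreeCycleRel H
  iseqv := ⟨fun _ => Or.inl rfl, ThreeCycleRel.symm, ThreeCycleRel.trans⟩

section Index

variable [Fintype α] {H : Subgroup (Perm α)}

/-- A set of representatives of the classes contains no three-cycle of `H`, so Bochert's bound
limits its size. -/
theorem card_threeCycleClasses_lt {v : ℕ} (hidx : H.index < (2 * v).factorial) :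
    Nat.card (Quotient (threeCycleSetoid H)) < 4 * v := by
  classical
  have : Fintype (Quotient (threeCycleSetoid H)) := Fintype.ofFinite _
  let T : Finset α := Finset.univ.image (Quotient.out : Quotient (threeCycleSetoid H) → α)
  have hT : T.card = Nat.card (Quotient (threeCycleSetoid H)) := by
    rw [Finset.card_image_of_injective _ Quotient.out_injective, Nat.card_eq_fintype_card]; rfl
  have hle := factorial_le_index_of_no_threeCycle (H := H) (T := T) (by
    intro i hi j hj k _ hij hik hjk hmem
    obtain ⟨q, -, rfl⟩ := Finset.mem_image.1 hi
    obtain ⟨q', -, rfl⟩ := Finset.mem_image.1 hj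
    refine hij (congrArg _ ?_)
    rw [← Quotient.out_eq q, ← Quotient.out_eq q']
    exact Quotient.sound (Or.inr ⟨hij, k, hik, hjk, hmem⟩))
  by_contra hc
  have : 2 * v ≤ (T.card + 1) / 2 := by omega
  exact absurd (hidx.trans_le (Nat.factorial_le this)) (not_lt.2 hle)

open Classical in
-- Every set of the size of the class of `o` is an image of that class under some `π`. It is already
-- determined by the coset of `π` and by a class, because pulling it back by the coset
-- representative gives a class of `H`.
theorem choose_card_class_le (H : Subgroup (Perm α)) (o : α) :
    (Fintype.card α).choose ({a | ThreeCycleRel H o a} : Finset α).card ≤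
      H.index * Nat.card (Quotient (threeCycleSetoid H)) := by
  set O : Finset α := {a | ThreeCycleRel H o a}
  have hex : ∀ A : {A : Finset α // A.card = O.card}, ∃ π : Perm α, ∀ a, π a ∈ A.1 ↔ a ∈ O := by
    rintro ⟨A, hA⟩
    let e : {x // x ∈ O} ≃ {x // x ∈ A} := Fintype.equivOfCardEq (by simp [hA])
    refine ⟨e.extendSubtype, fun a => ⟨fun h => ?_, fun h => e.extendSubtype_mem a h⟩⟩
    by_contra hc
    exact e.extendSubtype_not_mem a hc h
  choose π hπ using hex
  let f : {A : Finset α // A.card = O.card} → (Perm α ⧸ H) × Quotient (threeCycleSetoid H) :=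
    fun A => (QuotientGroup.mk (π A), Quotient.mk _ (((π A : Perm α ⧸ H).out)⁻¹ (π A o)))
  have key : ∀ A a, a ∈ A.1 ↔ (Quotient.mk (threeCycleSetoid H) (((f A).1.out)⁻¹ a)) = (f A).2 := by
    intro A a
    have hmem : ((f A).1.out)⁻¹ * π A ∈ H := QuotientGroup.eq.1 (Quotient.out_eq (f A).1)
    have h1 : a ∈ A.1 ↔ ThreeCycleRel H o ((π A)⁻¹ a) := by
      have := hπ A ((π A)⁻¹ a)
      rw [Perm.inv_def, Equiv.apply_symm_apply] at this
      rw [this, Perm.inv_def]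
      simp [O]
    rw [h1, Quotient.eq]
    constructor
    · intro h
      have := h.map hmem
      simp only [Perm.mul_apply, Perm.inv_def, Equiv.apply_symm_apply] at this
      exact this.symm
    · intro h
      have := (ThreeCycleRel.symm h).map (H.inv_mem hmem)
      simpa [Perm.mul_apply, Perm.inv_def, f] using this
  have hf : Function.Injective f := by
    intro A B hAB
    apply Subtype.ext
    ext a
    rw [key, key, hAB]
  have := Nat.card_le_card_of_injective f hf
  rwa [Nat.card_prod, Nat.card_eq_fintype_card, Fintype.card_finset_len] at this

open Classical in
/-- A subgroup of small index has a class containing almost all points. -/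
theorem exists_card_compl_class_lt {v : ℕ} (hv : 1 ≤ v) (hcard : (4 * v) ^ 2 ≤ Fintype.card α)
    (hidx : H.index < (2 * v).factorial) :
    ∃ o, ({a | ¬ ThreeCycleRel H o a} : Finset α).card < 4 * v := by
  have hQ := card_threeCycleClasses_lt hidx
  rw [Nat.card_eq_fintype_card] at hQ
  have hpos : 0 < Fintype.card α := lt_of_lt_of_le (by positivity) hcard
  have : Nonempty α := Fintype.card_pos_iff.1 hpos
  have : Nonempty (Quotient (threeCycleSetoid H)) := Nonempty.map (Quotient.mk _) ‹_›
  -- There are fewer than `4 * v` classes, so one has at least `4 * v` points. If its complement did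
  -- too, the number of sets of its size would exceed index times number of classes.
  obtain ⟨q, hq⟩ := Fintype.exists_le_card_fiber_of_mul_le_card
    (Quotient.mk (threeCycleSetoid H)) (n := 4 * v) (le_trans (by nlinarith) hcard)
  obtain ⟨o, rfl⟩ := Quotient.exists_rep q
  have hO : ({a | Quotient.mk (threeCycleSetoid H) a = Quotient.mk _ o} : Finset α) =
      ({a | ThreeCycleRel H o a} : Finset α) := by
    ext a
    simp only [Finset.mem_filter, Finset.mem_univ, true_and, Quotient.eq]
    exact ⟨ThreeCycleRel.symm, ThreeCycleRel.symm⟩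
  rw [hO] at hq
  refine ⟨o, ?_⟩
  by_contra hc
  have hsum := Finset.card_filter_add_card_filter_not (s := (Finset.univ : Finset α))
      (fun a => ThreeCycleRel H o a)
  rw [Finset.card_univ] at hsum
  have h1 := choose_card_class_le H o
  have h2 := Nat.choose_le_choose_of_le_of_add_le (n := Fintype.card α) hq (by omega)
  have h3 := factorial_mul_lt_choose hv hcard
  rw [Nat.card_eq_fintype_card] at h1
  have h4 : H.index * Fintype.card (Quotient (threeCycleSetoid H)) ≤
    (2 * v).factorial * (4 * v) := Nat.mul_le_mul hidx.le hQ.le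
  omega

open Classical in
-- Elements of `H` permute the classes. The class of `o` is larger than its complement, so it meets
-- its image under `σ` and is preserved. Among `d` distinct points of the orbit of `b`, one lies in
-- the class, hence `b` does.
theorem rel_of_long_orbit {d : ℕ} {o : α} (hd : ({a | ¬ ThreeCycleRel H o a} : Finset α).card < d)
    (hdO : 2 * d ≤ Fintype.card α) {σ : Perm α} (hσ : σ ∈ H) {b : α}
    (hb : ∀ i < d, ∀ j < d, (σ ^ i) b = (σ ^ j) b → i = j) : ThreeCycleRel H o b := by
  obtain ⟨c, hc, hσc⟩ : ∃ c, ThreeCycleRel H o c ∧ ThreeCycleRel H o (σ c) := by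
    by_contra hno
    push Not at hno
    have hsum := Finset.card_filter_add_card_filter_not (s := (Finset.univ : Finset α))
      (fun a => ThreeCycleRel H o a)
    rw [Finset.card_univ] at hsum
    have := Finset.card_le_card_of_injOn (s := ({a | ThreeCycleRel H o a} : Finset α))
      (t := ({a | ¬ ThreeCycleRel H o a} : Finset α)) σ (fun a ha => by
        simp only [Finset.coe_filter, Finset.mem_univ, true_and, Set.mem_ofPred_eq] at ha ⊢
        exact hno a ha) σ.injective.injOn
    omega
  have hback : ∀ a, ThreeCycleRel H o (σ a) → ThreeCycleRel H o a := by
    intro a ha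
    have := (hσc.symm.trans ha).map (H.inv_mem hσ)
    simp only [Perm.inv_def, Equiv.symm_apply_apply] at this
    exact hc.trans this
  obtain ⟨i, hi, hrel⟩ : ∃ i < d, ThreeCycleRel H o ((σ ^ i) b) := by
    by_contra hno
    push Not at hno
    have := Finset.card_le_card_of_injOn (s := Finset.range d)
      (t := ({a | ¬ ThreeCycleRel H o a} : Finset α)) (fun i => (σ ^ i) b) (fun i hi => by
        simp only [Finset.coe_filter, Finset.mem_univ, true_and, Set.mem_ofPred_eq]
        exact hno i (by simpa using hi)) (fun i hi j hj h =>
          hb i (by simpa using hi) j (by simpa using hj) h)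
    rw [Finset.card_range] at this
    omega
  clear hi
  induction i with
  | zero => simpa using hrel
  | succ i ih => exact ih (hback _ (by rwa [pow_succ', Perm.mul_apply] at hrel))

end Index

theorem viaEmbedding_swap (ι : β ↪ α) (a b : β) :
    (swap a b).viaEmbedding ι = swap (ι a) (ι b) := by
  ext x
  by_cases hx : x ∈ Set.range ι
  · obtain ⟨y, rfl⟩ := hx
    rw [Perm.viaEmbedding_apply, ι.injective.map_swap]
  · rw [Perm.viaEmbedding_apply_of_notMem _ _ _ hx, swap_apply_of_ne_of_ne]
    · rintro rfl; exact hx ⟨a, rfl⟩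
    · rintro rfl; exact hx ⟨b, rfl⟩

/-- If the range of `ι` lies in one class, then `H` contains the alternating group on it. -/
theorem map_alternatingGroup_le [Fintype β] {H : Subgroup (Perm α)} (ι : β ↪ α) {o : α}
    (h : ∀ b, ThreeCycleRel H o (ι b)) :
    (alternatingGroup β).map (Perm.viaEmbeddingHom ι) ≤ H := by
  rw [← Perm.closure_three_cycles_eq_alternating, Subgroup.map_le_iff_le_comap,
    Subgroup.closure_le]
  intro g hg
  obtain ⟨a, ha⟩ : ∃ a, a ∈ g.support := by
    have := Perm.IsThreeCycle.card_support hg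
    exact Finset.card_pos.1 (by omega)
  have hnd := (Perm.IsThreeCycle.nodup_iff_mem_support hg).2 ha
  simp only [List.nodup_cons, List.mem_cons, List.not_mem_nil, or_false, not_or] at hnd
  rw [(Perm.IsThreeCycle.eq_swap_mul_swap_iff_mem_support hg).2 ha]
  simp only [SetLike.mem_coe, Subgroup.mem_comap, map_mul, Perm.viaEmbeddingHom_apply,
    viaEmbedding_swap]
  refine ThreeCycleRel.threeCycle_mem (ι.injective.ne hnd.1.1) (ι.injective.ne hnd.1.2)
    (ι.injective.ne hnd.2.1) ((h _).symm.trans (h _)) ((h _).symm.trans (h _))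

end SmallIndex

/-! ### Evaluation and symmetry of circuits -/

section PowerSums

open Equiv

/-- A function with values in `ZMod (p ^ a)` that is invariant under a permutation of `p`-power order
and vanishes on its short orbits has sum `0`. -/
theorem sum_eq_zero_of_pow_order {γ : Type*} [Fintype γ] {p a b : ℕ} (hp : p.Prime)
    (σ : Perm γ) (hσ : σ ^ p ^ b = 1) (F : γ → ZMod (p ^ a)) (hF : ∀ g, F (σ g) = F g)
    (h0 : ∀ g, (σ ^ p ^ (a - 1)) g = g → F g = 0) : ∑ g, F g = 0 := by
  classical
  let G := Subgroup.zpowers σ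
  have hinv : ∀ τ ∈ G, ∀ g, F (τ g) = F g := by
    rintro τ hτ
    obtain ⟨z, rfl⟩ := Subgroup.mem_zpowers_iff.1 hτ
    clear hτ
    induction z with
    | zero => simp
    | succ j ih => intro g; rw [zpow_add_one, Perm.mul_apply, ih, hF]
    | pred j ih =>
      intro g
      rw [zpow_sub_one, Perm.mul_apply, ih, ← hF, Perm.inv_def, Equiv.apply_symm_apply]
  have : Fintype (MulAction.orbitRel.Quotient G γ) := Fintype.ofFinite _
  rw [← Finset.sum_fiberwise (g := fun g => (Quotient.mk _ g : MulAction.orbitRel.Quotient G γ))]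
  refine Finset.sum_eq_zero fun ω _ => ?_
  obtain ⟨g, rfl⟩ := Quotient.exists_rep ω
  have hmem : ∀ g', (Quotient.mk _ g' : MulAction.orbitRel.Quotient G γ) = Quotient.mk _ g ↔
      g' ∈ MulAction.orbit G g := fun g' => by
    rw [Quotient.eq]; rfl
  have hconst : ∀ g' ∈ ({g' | (Quotient.mk _ g' : MulAction.orbitRel.Quotient G γ) =
      Quotient.mk _ g} : Finset γ), F g' = F g := by
    intro g' hg'
    simp only [Finset.mem_filter, Finset.mem_univ, true_and] at hg'
    obtain ⟨⟨τ, hτ⟩, rfl⟩ := (hmem g').1 hg'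
    exact hinv τ hτ g
  rw [Finset.sum_congr rfl hconst, Finset.sum_const]
  have hcard : ({g' | (Quotient.mk _ g' : MulAction.orbitRel.Quotient G γ) =
      Quotient.mk _ g} : Finset γ).card = Function.minimalPeriod (σ • ·) g := by
    rw [MulAction.minimalPeriod_eq_card, ← Set.toFinset_card]
    congr 1
    ext g'
    simp only [Finset.mem_filter, Finset.mem_univ, true_and, hmem, Set.mem_toFinset]
    rfl
  rw [hcard]
  have hper : ∀ j, (σ ^ j) g = g ↔ Function.minimalPeriod (σ • ·) g ∣ j := by
    intro j
    rw [← Function.isPeriodicPt_iff_minimalPeriod_dvd, Function.IsPeriodicPt,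
      Function.IsFixedPt, smul_iterate]
    rfl
  -- An orbit has length `p ^ c`: either it is short and `F` vanishes on it, or its length is
  -- already zero modulo `p ^ a`.
  obtain ⟨c, -, hc⟩ := (Nat.dvd_prime_pow hp).1 ((hper (p ^ b)).1 (by rw [hσ]; rfl))
  rw [hc]
  by_cases hca : c ≤ a - 1
  · rw [h0 g ((hper _).2 (hc ▸ pow_dvd_pow p hca)), smul_zero]
  · rw [nsmul_eq_mul, (ZMod.natCast_eq_zero_iff _ _).2 (pow_dvd_pow p (by omega : a ≤ c)), zero_mul]

end PowerSums

namespace ModCircuit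

open Equiv

variable {m n : ℕ} (C : ModCircuit m n)

theorem eval_of_label_inl (x : Fin n → Bool) {g : C.Gate} {i : Fin n} (h : C.label g = Sum.inl i) :
    C.eval x g = x i := by
  unfold eval
  rw [WellFounded.fix_eq]
  simp only [h]

open Classical in
theorem eval_of_label_inr (x : Fin n → Bool) {g : C.Gate} {R : Set (ZMod m)}
    (h : C.label g = Sum.inr R) :
    C.eval x g = decide (((∑ g', C.wires g' g * (C.eval x g').toNat : ℕ) : ZMod m) ∈ R) := by
  unfold eval
  rw [WellFounded.fix_eq]
  simp only [h]
  have : ∑ g', (if w : 0 < C.wires g' g then C.wires g' g * (C.eval x g').toNat else 0) =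
      ∑ g', C.wires g' g * (C.eval x g').toNat := by
    refine Finset.sum_congr rfl fun g' _ => ?_
    split_ifs with hw
    · rfl
    · simp [Nat.eq_zero_of_not_pos hw]
  exact congrArg (fun s : ℕ => decide ((s : ZMod m) ∈ R)) this

variable {C}

theorem modEq_of_forall_primeFactors {m a b : ℕ} (hm : m ≠ 0)
    (h : ∀ p ∈ m.primeFactors, (a : ZMod (p ^ m.factorization p)) = b) : a ≡ b [MOD m] := by
  rw [Nat.modEq_iff_dvd, Int.natCast_dvd, Nat.dvd_iff_prime_pow_dvd_dvd]
  intro p k hp hk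
  rcases Nat.eq_zero_or_pos k with rfl | hk0
  · simp
  have hpm : p ∈ m.primeFactors :=
    Nat.mem_primeFactors.2 ⟨hp, (dvd_pow_self p hk0.ne').trans hk, hm⟩
  refine (pow_dvd_pow p ((hp.pow_dvd_iff_le_factorization hm).1 hk)).trans ?_
  rw [← Int.natCast_dvd, ← Nat.modEq_iff_dvd]
  exact (ZMod.natCast_eq_natCast_iff _ _ _).1 (h p hpm)

theorem IsAutExtending.one : C.IsAutExtending 1 1 :=
  ⟨fun _ _ h => h, fun _ _ h => h, fun _ _ => rfl⟩

theorem IsAutExtending.mul {π π' : Perm (Fin n)} {σ σ' : Perm C.Gate}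
    (h : C.IsAutExtending π σ) (h' : C.IsAutExtending π' σ') :
    C.IsAutExtending (π * π') (σ * σ') :=
  ⟨fun g i hg => h.1 _ _ (h'.1 g i hg), fun g R hg => h.2.1 _ _ (h'.2.1 g R hg),
    fun _ _ => (h.2.2 _ _).trans (h'.2.2 _ _)⟩

theorem IsAutExtending.pow {π : Perm (Fin n)} {σ : Perm C.Gate} (h : C.IsAutExtending π σ) (j : ℕ) :
    C.IsAutExtending (π ^ j) (σ ^ j) := by
  induction j with
  | zero => exact .one
  | succ j ih => rw [pow_succ, pow_succ]; exact ih.mul h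

theorem IsAutExtending.inv {π : Perm (Fin n)} {σ : Perm C.Gate} (h : C.IsAutExtending π σ) :
    C.IsAutExtending π⁻¹ σ⁻¹ := by
  have h1 : ∀ g, σ (σ⁻¹ g) = g := fun g => by rw [← Perm.mul_apply, mul_inv_cancel]; rfl
  refine ⟨fun g i hg => ?_, fun g R hg => ?_, fun g g' => ?_⟩
  · rcases hl : C.label (σ⁻¹ g) with j | R
    · have := h.1 _ _ hl
      rw [h1, hg, Sum.inl.injEq] at this
      rw [this, ← Perm.mul_apply, inv_mul_cancel]
      rfl
    · have := h.2.1 _ _ hl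
      rw [h1, hg] at this
      cases this
  · rcases hl : C.label (σ⁻¹ g) with j | R'
    · have := h.1 _ _ hl
      rw [h1, hg] at this
      cases this
    · have := h.2.1 _ _ hl
      rw [h1, hg, Sum.inr.injEq] at this
      rw [this]
  · rw [← h.2.2, h1, h1]

theorem IsAutExtending.eval_eq {π : Perm (Fin n)} {σ : Perm C.Gate} (h : C.IsAutExtending π σ)
    {x : Fin n → Bool} (hx : ∀ i, x (π i) = x i) (g : C.Gate) : C.eval x (σ g) = C.eval x g := by
  classical
  induction g using C.acyclic.induction with
  | _ g ih =>
    rcases hl : C.label g with i | R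
    · rw [C.eval_of_label_inl x hl, C.eval_of_label_inl x (h.1 g i hl), hx]
    · rw [C.eval_of_label_inr x hl, C.eval_of_label_inr x (h.2.1 g R hl), ← Equiv.sum_comp σ]
      have : ∑ g', C.wires (σ g') (σ g) * (C.eval x (σ g')).toNat =
          ∑ g', C.wires g' g * (C.eval x g').toNat := by
        refine Finset.sum_congr rfl fun g' _ => ?_
        rw [h.2.2]
        rcases Nat.eq_zero_or_pos (C.wires g' g) with hw | hw
        · simp [hw]
        · rw [ih g' hw]
      rw [this]

/-! ### Gate stabilizers and indistinguishable inputs -/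

section Stabilizer

variable {Ω : Type*} (θ : Perm Ω →* Perm (Fin n))

variable (C) in
/-- The permutations for which some corresponding circuit automorphism fixes the gate `g`. -/
def gateStabilizer (g : C.Gate) : Subgroup (Perm Ω) where
  carrier := {π | ∃ σ, C.IsAutExtending (θ π) σ ∧ σ g = g}
  one_mem' := ⟨1, by rw [map_one]; exact .one, rfl⟩
  mul_mem' := by
    rintro π π' ⟨σ, hσ, hg⟩ ⟨σ', hσ', hg'⟩
    exact ⟨σ * σ', by rw [map_mul]; exact hσ.mul hσ', by rw [Perm.mul_apply, hg', hg]⟩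
  inv_mem' := by
    rintro π ⟨σ, hσ, hg⟩
    exact ⟨σ⁻¹, by rw [map_inv]; exact hσ.inv, by rw [Perm.inv_eq_iff_eq, hg]⟩

/-- Extensions to the circuit need not be unique, so there is no action on the gates to use. The
orbit argument still works with chosen extensions: if those of two coset representatives send `g` to
the same gate, their quotient is an extension fixing `g`. -/
theorem index_gateStabilizer_le (hθ : ∀ π, ∃ σ, C.IsAutExtending (θ π) σ) (g : C.Gate) :
    (C.gateStabilizer θ g).index ≤ Fintype.card C.Gate := by
  choose σ hσ using hθ
  have hinj : Function.Injective
      (fun q : Perm Ω ⧸ C.gateStabilizer θ g => σ q.out g) := by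
    intro q q' h
    rw [← Quotient.out_eq q, ← Quotient.out_eq q']
    refine QuotientGroup.eq.2 ⟨(σ q.out)⁻¹ * σ q'.out, ?_, ?_⟩
    · rw [map_mul, map_inv]
      exact (hσ _).inv.mul (hσ _)
    · rw [Perm.mul_apply, Perm.inv_eq_iff_eq]
      exact h.symm
  have := Nat.card_le_card_of_injective _ hinj
  rwa [Nat.card_eq_fintype_card (α := C.Gate)] at this

/-- The main induction: gates that are stabilized by a sufficiently rich group `E` cannot distinguish
two `E`-invariant inputs. -/
theorem eval_eq_of_le_gateStabilizer (hm : m ≠ 0) {E : Subgroup (Perm Ω)}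
    (hE : ∀ p ∈ m.primeFactors, ∃ τ ∈ E, ∃ e, τ ^ p ^ e = 1 ∧
      ∀ g, τ ^ p ^ (m.factorization p - 1) ∈ C.gateStabilizer θ g → E ≤ C.gateStabilizer θ g)
    {x y : Fin n → Bool} (hx : ∀ π ∈ E, ∀ i, x (θ π i) = x i) (hy : ∀ π ∈ E, ∀ i, y (θ π i) = y i)
    (hxy : ∀ g i, C.label g = Sum.inl i → E ≤ C.gateStabilizer θ g → x i = y i)
    (g : C.Gate) (hg : E ≤ C.gateStabilizer θ g) : C.eval x g = C.eval y g := by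
  classical
  induction g using C.acyclic.induction with
  | _ g ih =>
    rcases hl : C.label g with i | R
    · rw [C.eval_of_label_inl x hl, C.eval_of_label_inl y hl, hxy g i hl hg]
    rw [C.eval_of_label_inr x hl, C.eval_of_label_inr y hl]
    suffices h : ((∑ g', C.wires g' g * (C.eval x g').toNat : ℕ) : ZMod m) =
        ((∑ g', C.wires g' g * (C.eval y g').toNat : ℕ) : ZMod m) by rw [h]
    rw [ZMod.natCast_eq_natCast_iff]
    refine modEq_of_forall_primeFactors hm fun p hp => ?_
    have hpp := Nat.prime_of_mem_primeFactors hp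
    obtain ⟨τ, hτE, e, hτ1, hτ⟩ := hE p hp
    obtain ⟨σ, hσ, hσg⟩ := hg hτE
    -- replace `σ` by a power of order a power of `p`
    obtain ⟨b, t, htp, hbt⟩ := Nat.exists_eq_pow_mul_and_not_dvd (orderOf_pos σ).ne' p hpp.ne_one
    -- The exponent `t` is prime to `p`, hence invertible modulo the order of `τ`: passing to `t`-th
    -- powers loses nothing.
    obtain ⟨u, hu⟩ : ∃ u, (τ ^ t) ^ u = τ := by
      refine exists_pow_eq_self_of_coprime (Nat.Coprime.coprime_dvd_right
        (orderOf_dvd_of_pow_eq_one hτ1) (Nat.Coprime.pow_right _ ?_))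
      exact ((Nat.Prime.coprime_iff_not_dvd hpp).2 htp).symm
    have hσt : (σ ^ t) ^ p ^ b = 1 := by
      rw [← pow_mul, mul_comm, ← hbt, pow_orderOf_eq_one]
    have hσtg : ∀ g', C.wires ((σ ^ t) g') g = C.wires g' g := by
      intro g'
      have h1 : (σ ^ t) g = g := Function.IsFixedPt.perm_pow hσg t
      conv_lhs => rw [← h1]
      exact (hσ.pow t).2.2 _ _
    have hfix : ∀ π ∈ E, ∀ g', ∀ σ', C.IsAutExtending (θ π) σ' →
        C.eval x (σ' g') = C.eval x g' ∧ C.eval y (σ' g') = C.eval y g' :=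
      fun π hπ g' σ' h => ⟨h.eval_eq (hx π hπ) g', h.eval_eq (hy π hπ) g'⟩
    have hσt' : C.IsAutExtending (θ (τ ^ t)) (σ ^ t) := by rw [map_pow]; exact hσ.pow t
    rw [← sub_eq_zero]
    push_cast
    rw [← Finset.sum_sub_distrib]
    -- The summand is the wire multiplicity times the difference of the two values. On a short
    -- orbit, `τ ^ p ^ (a - 1)` stabilizes `g'`, where `a` is the exponent of `p` in `m`; so all of
    -- `E` does, and the induction hypothesis makes the difference zero.
    refine sum_eq_zero_of_pow_order (b := b) hpp (σ ^ t) hσt _ (fun g' => ?_) fun g' hg' => ?_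
    · obtain ⟨h1, h2⟩ := hfix _ (E.pow_mem hτE t) g' _ hσt'
      rw [h1, h2, hσtg]
    · rcases Nat.eq_zero_or_pos (C.wires g' g) with hw | hw
      · simp [hw]
      · rw [ih g' hw (hτ g' ?_), sub_self]
        have h1 : (τ ^ t) ^ p ^ (m.factorization p - 1) ∈ C.gateStabilizer θ g' :=
          ⟨_, by rw [map_pow]; exact hσt'.pow _, hg'⟩
        have h2 := Subgroup.pow_mem _ h1 u
        rwa [← pow_mul, mul_comm _ u, pow_mul, hu] at h2

end Stabilizer

end ModCircuit

/-! ### Even permutations of prime power order with long cycles -/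

section Translation

open Equiv

theorem addRight_pow_apply {A : Type*} [AddGroup A] (s : A) (k : ℕ) (b : A) :
    ((Equiv.addRight s ^ k : Perm A)) b = b + k • s := by
  induction k with
  | zero => simp
  | succ k ih =>
    rw [pow_succ', Perm.mul_apply, ih, succ_nsmul]
    exact add_assoc _ _ _

/-- For `M` a multiple of `p ^ (l + a - 1)`, the translation by `2 * M / p ^ (l + a - 1)` on
`ZMod (2 * M)` is an even permutation of `p`-power order, and its `p ^ (a - 1)`-th power has only
orbits of length `p ^ l`. -/
theorem exists_translation {M p l a : ℕ} [NeZero (2 * M)] (hp : 0 < p)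
    (hM : p ^ (l + (a - 1)) ∣ M) :
    ∃ τ ∈ alternatingGroup (ZMod (2 * M)), (∃ e, τ ^ p ^ e = 1) ∧
      ∀ b, ∀ i < p ^ l, ∀ j < p ^ l,
        ((τ ^ p ^ (a - 1)) ^ i) b = ((τ ^ p ^ (a - 1)) ^ j) b → i = j := by
  obtain ⟨s, rfl⟩ := hM
  set N := 2 * (p ^ (l + (a - 1)) * s)
  have hs : 0 < s := by
    rcases Nat.eq_zero_or_pos s with rfl | hs
    · exact absurd (by simp [N]) (NeZero.ne N)
    · exact hs
  -- Translation by `2 * s`, written as a square so that it is even for every `p`, including `2`;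
  -- the factor `2` in the modulus compensates for this in the order.
  refine ⟨(Equiv.addRight (s : ZMod N)) ^ 2, ?_, ⟨l + (a - 1), ?_⟩, ?_⟩
  · rw [Perm.mem_alternatingGroup, map_pow, Int.units_sq]
  · ext b
    rw [← pow_mul, addRight_pow_apply, nsmul_eq_mul]
    have : ((2 * p ^ (l + (a - 1)) : ℕ) : ZMod N) * (s : ZMod N) = ((N : ℕ) : ZMod N) := by
      rw [← Nat.cast_mul]
      congr 1
      simp only [N]
      ring
    rw [this, ZMod.natCast_self, add_zero]
    rfl
  · intro b i hi j hj h
    simp only [← pow_mul, addRight_pow_apply] at h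
    have h1 := add_left_cancel h
    simp only [nsmul_eq_mul, ← Nat.cast_mul] at h1
    rw [ZMod.natCast_eq_natCast_iff] at h1
    have h2 : i * (2 * p ^ (a - 1) * s) ≡ j * (2 * p ^ (a - 1) * s)
        [MOD p ^ l * (2 * p ^ (a - 1) * s)] := by
      have hN : p ^ l * (2 * p ^ (a - 1) * s) = N := by simp only [N, pow_add]; ring
      rw [hN]
      convert h1 using 1 <;> ring
    have h3 := Nat.ModEq.mul_right_cancel' (by positivity) h2
    rwa [Nat.ModEq, Nat.mod_eq_of_lt hi, Nat.mod_eq_of_lt hj] at h3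

end Translation

/-! ### The lower bound on the number of gates -/

namespace ModCircuit

open Equiv

variable {m n : ℕ}

/-- A circuit for `AND` that is symmetric under a large symmetric group acting on blocks of
variables (the block of `i` being `f i`) has many gates. -/
theorem factorial_le_card_gate {C : ModCircuit m n} (hr : 2 ≤ m.primeFactors.card)
    (hC : C.ComputesAnd) {Ω : Type*} [Fintype Ω] (θ : Perm Ω →* Perm (Fin n))
    (hθ : ∀ π, ∃ σ, C.IsAutExtending (θ π) σ) {f : Fin n → Ω} (hf : Function.Surjective f)
    (hfθ : ∀ π i, f (θ π i) = π (f i)) {v : ℕ} (hv : 1 ≤ v)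
    (hΩ : 4 * m * (4 * v) ^ m.primeFactors.card ≤ Fintype.card Ω) :
    (2 * v).factorial ≤ Fintype.card C.Gate := by
  classical
  by_contra hlt
  rw [not_le] at hlt
  have hm : m ≠ 0 := by rintro rfl; simp at hr
  have hm1 : 1 ≤ m := Nat.pos_of_ne_zero hm
  set r := m.primeFactors.card with hrdef
  have hd1 : 4 * v ≤ (4 * v) ^ r := Nat.le_self_pow (by omega) _
  have hd2 : (4 * v) ^ 2 ≤ (4 * v) ^ r := Nat.pow_le_pow_right (by omega) hr
  have hmr : (4 * v) ^ r ≤ m * (4 * v) ^ r := Nat.le_mul_of_pos_left _ hm1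
  have hidx : ∀ g, (C.gateStabilizer θ g).index < (2 * v).factorial :=
    fun g => (index_gateStabilizer_le θ hθ g).trans_lt hlt
  have hlarge : ∀ g, ∃ o, ({a | ¬ ThreeCycleRel (C.gateStabilizer θ g) o a} : Finset Ω).card
      < 4 * v := fun g => exists_card_compl_class_lt hv (by nlinarith) (hidx g)
  -- Chosen so that after raising to the power `p ^ (m.factorization p - 1)` the cycles still have
  -- length at least `4 * v`, the bound on the complement of a dominant class.
  let E₀ : ℕ → ℕ := fun p => Nat.clog p (4 * v) + (m.factorization p - 1)
  let M := ∏ p ∈ m.primeFactors, p ^ E₀ p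
  have hpow : ∀ p ∈ m.primeFactors, p ^ E₀ p ≤ (4 * v) * p ^ m.factorization p := by
    intro p hp
    have hpp := Nat.prime_of_mem_primeFactors hp
    have h1 := Nat.pow_pred_clog_lt_self hpp.one_lt (x := 4 * v) (by omega)
    have h2 : 0 < Nat.clog p (4 * v) := Nat.clog_pos hpp.one_lt (by omega)
    have h3 : 0 < m.factorization p := hpp.factorization_pos_of_dvd hm
      (Nat.dvd_of_mem_primeFactors hp)
    have : E₀ p = (Nat.clog p (4 * v)).pred + m.factorization p := by
      simp only [E₀, Nat.pred_eq_sub_one]; omega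
    rw [this, pow_add]
    exact Nat.mul_le_mul_right _ h1.le
  have hM : M ≤ m * (4 * v) ^ r := by
    calc M ≤ ∏ p ∈ m.primeFactors, ((4 * v) * p ^ m.factorization p) :=
          Finset.prod_le_prod' hpow
      _ = m * (4 * v) ^ r := by
          rw [Finset.prod_mul_distrib, Finset.prod_const, mul_comm]
          congr 1
          exact Nat.prod_factorization_pow_eq_self hm
  have hM0 : 0 < M := Finset.prod_pos fun p hp =>
    Nat.pow_pos (Nat.prime_of_mem_primeFactors hp).pos
  have : NeZero (2 * M) := ⟨by omega⟩
  obtain ⟨o, ho⟩ := hlarge C.root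
  have hsum := Finset.card_filter_add_card_filter_not (s := (Finset.univ : Finset Ω))
    (fun a => ThreeCycleRel (C.gateStabilizer θ C.root) o a)
  rw [Finset.card_univ] at hsum
  obtain ⟨ι₀⟩ : Nonempty (ZMod (2 * M) ↪ {a // ThreeCycleRel (C.gateStabilizer θ C.root) o a}) := by
    refine Function.Embedding.nonempty_of_card_le ?_
    rw [ZMod.card, Fintype.card_subtype]
    -- Half of this quantity bounds `2 * M`, and the other half pays for the fewer than `4 * v`
    -- points outside the class.
    have : 4 * m * (4 * v) ^ r = 4 * (m * (4 * v) ^ r) := by ring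
    omega
  let ι : ZMod (2 * M) ↪ Ω := ι₀.trans (Function.Embedding.subtype _)
  let E := (alternatingGroup (ZMod (2 * M))).map (Perm.viaEmbeddingHom ι)
  have hroot : E ≤ C.gateStabilizer θ C.root :=
    map_alternatingGroup_le ι (o := o) fun b => (ι₀ b).2
  have hτ : ∀ p ∈ m.primeFactors, ∃ τ ∈ E, (∃ e, τ ^ p ^ e = 1) ∧
      ∀ b, ∀ i < 4 * v, ∀ j < 4 * v, ((τ ^ p ^ (m.factorization p - 1)) ^ i) (ι b) =
        ((τ ^ p ^ (m.factorization p - 1)) ^ j) (ι b) → i = j := by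
    intro p hp
    have hpp := Nat.prime_of_mem_primeFactors hp
    obtain ⟨τ, hτ, ⟨e, he⟩, hinj⟩ := exists_translation (M := M) (a := m.factorization p) hpp.pos
      (Finset.dvd_prod_of_mem (fun p => p ^ E₀ p) hp)
    have hle := Nat.le_pow_clog hpp.one_lt (4 * v)
    refine ⟨_, Subgroup.mem_map_of_mem _ hτ, ⟨e, by rw [← map_pow, he, map_one]⟩, ?_⟩
    intro b i hi j hj h
    rw [← map_pow, ← map_pow, ← map_pow, Perm.viaEmbeddingHom_apply, Perm.viaEmbeddingHom_apply,
      Perm.viaEmbedding_apply, Perm.viaEmbedding_apply] at h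
    exact hinj b i (by omega) j (by omega) (ι.injective h)
  have hrange : ∀ π ∈ E, ∀ a, π a ∈ Set.range ι ↔ a ∈ Set.range ι := by
    rintro _ ⟨e, -, rfl⟩ a
    rw [Perm.viaEmbeddingHom_apply]
    by_cases ha : a ∈ Set.range ι
    · obtain ⟨b, rfl⟩ := ha
      simp [Perm.viaEmbedding_apply]
    · rw [Perm.viaEmbedding_apply_of_notMem _ _ _ ha]
  obtain ⟨p₀, hp₀⟩ : ∃ p, p ∈ m.primeFactors := Finset.card_pos.1 (by omega)
  let y : Fin n → Bool := fun i => decide (f i ∉ Set.range ι)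
  have heval : C.eval (fun _ => true) C.root = C.eval y C.root := by
    refine eval_eq_of_le_gateStabilizer θ hm (E := E) ?_ (fun _ _ _ => rfl) ?_ ?_ _ hroot
    · intro p hp
      obtain ⟨τ, hτE, ⟨e, he⟩, hinj⟩ := hτ p hp
      refine ⟨τ, hτE, e, he, fun g hg => ?_⟩
      obtain ⟨o', ho'⟩ := hlarge g
      exact map_alternatingGroup_le ι (o := o') fun b =>
        rel_of_long_orbit ho' (by nlinarith) hg (hinj b)
    · intro π hπ i
      simp only [y, hfθ, hrange π hπ]
    · intro g i hgi hg
      by_contra hne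
      -- The two inputs differ only on blocks in the range of `ι`. The power of `τ` moves every such
      -- block, so it cannot stabilize an input gate there.
      have hi : f i ∈ Set.range ι := by
        by_contra h
        exact hne (decide_eq_true h).symm
      obtain ⟨b, hb⟩ := hi
      obtain ⟨τ, hτE, -, hinj⟩ := hτ p₀ hp₀
      obtain ⟨σ, hσ, hσg⟩ := hg (E.pow_mem hτE (p₀ ^ (m.factorization p₀ - 1)))
      have h1 := hσ.1 g i hgi
      rw [hσg, hgi, Sum.inl.injEq] at h1
      have h2 := hfθ (τ ^ p₀ ^ (m.factorization p₀ - 1)) i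
      rw [← h1, ← hb] at h2
      exact absurd (hinj b 0 (by omega) 1 (by omega) (by simpa using h2)) (by omega)
  have h1 := (hC fun _ => true).2 fun _ => rfl
  rw [heval] at h1
  obtain ⟨i, hi⟩ := hf (ι 0)
  have h2 := (hC y).1 h1 i
  simp [y, hi] at h2

end ModCircuit

/-! ### Symmetric groups inside the automorphism group of the tree -/

namespace TreeNode

open Equiv

variable {h : ℕ} {k : Fin h → ℕ}

/-- Permuting, at every level, the children of all nodes in the same way. -/
def permute (ρ : ∀ i, Perm (Fin (k i))) (v : TreeNode k) : TreeNode k :=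
  ⟨v.level, v.level_le, fun i hi => ρ i (v.path i hi)⟩

theorem permute_permute (ρ ρ' : ∀ i, Perm (Fin (k i))) (v : TreeNode k) :
    permute ρ (permute ρ' v) = permute (ρ * ρ') v := rfl

theorem permute_one (v : TreeNode k) : permute 1 v = v := rfl

theorem hasChild_permute (ρ : ∀ i, Perm (Fin (k i))) (u v : TreeNode k) :
    (permute ρ u).HasChild (permute ρ v) ↔ u.HasChild v := by
  simp only [HasChild, permute, EmbeddingLike.apply_eq_iff_eq]

/-- `permute` as an automorphism of the tree. -/
def permuteIso (ρ : ∀ i, Perm (Fin (k i))) :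
    HasChild (k := k) ≃r HasChild (k := k) where
  toFun := permute ρ
  invFun := permute ρ⁻¹
  left_inv v := by rw [permute_permute, inv_mul_cancel, permute_one]
  right_inv v := by rw [permute_permute, mul_inv_cancel, permute_one]
  map_rel_iff' := hasChild_permute ρ _ _

/-- The action of `permute` on the leaves. -/
def permuteLeaves : (∀ i, Perm (Fin (k i))) →* Perm (TreeLeaf k) where
  toFun ρ :=
    { toFun := fun v => ⟨permute ρ v.1, v.2⟩
      invFun := fun v => ⟨permute ρ⁻¹ v.1, v.2⟩
      left_inv := fun v => Subtype.ext ((permuteIso ρ).left_inv v.1)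
      right_inv := fun v => Subtype.ext ((permuteIso ρ).right_inv v.1) }
  map_one' := rfl
  map_mul' _ _ := rfl

theorem permCongr_permuteLeaves_mem {n : ℕ} (e : TreeLeaf k ≃ Fin n) (ρ : ∀ i, Perm (Fin (k i))) :
    e.permCongrHom (permuteLeaves ρ) ∈ treeAut k e := by
  refine ⟨permuteIso ρ, fun i => ?_⟩
  change _ = (e.symm (e (permuteLeaves ρ (e.symm i)))).1
  rw [e.symm_apply_apply]
  rfl

end TreeNode

/-- Only the automorphisms permuting the coordinate `i₀` of all paths simultaneously are needed; the
block of a leaf is its coordinate `i₀`. -/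
theorem factorial_le_size {m n h : ℕ} {k : Fin h → ℕ} (hk : ∀ i, 0 < k i) (e : TreeLeaf k ≃ Fin n)
    {C : ModCircuit m n} (hr : 2 ≤ m.primeFactors.card) (hsymm : C.IsSymmetric (treeAut k e))
    (hC : C.ComputesAnd) {v : ℕ} (hv : 1 ≤ v) (i₀ : Fin h)
    (hle : 4 * m * (4 * v) ^ m.primeFactors.card ≤ k i₀) : (2 * v).factorial ≤ C.size := by
  let θ : Equiv.Perm (Fin (k i₀)) →* Equiv.Perm (Fin n) :=
    (e.permCongrHom.toMonoidHom.comp TreeNode.permuteLeaves).comp (MonoidHom.mulSingle (fun i => Equiv.Perm (Fin (k i))) i₀)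
  let f : Fin n → Fin (k i₀) := fun i => (e.symm i).1.path i₀ (by rw [(e.symm i).2]; exact Nat.zero_le _)
  refine (ModCircuit.factorial_le_card_gate hr hC θ (f := f)
    (fun π => hsymm _ (TreeNode.permCongr_permuteLeaves_mem e _)) ?_ ?_ hv
    (by rwa [Fintype.card_fin])).trans (Nat.le_add_right _ _)
  · intro a
    let u : TreeLeaf k := ⟨⟨0, Nat.zero_le _, fun i _ => if hi : i = i₀ then hi ▸ a else ⟨0, hk i⟩⟩, rfl⟩
    refine ⟨e u, ?_⟩
    have : ∀ w : TreeLeaf k, w = u → ∀ hw, w.1.path i₀ hw = a := by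
      rintro w rfl _
      simp [u]
    exact this _ (e.symm_apply_apply u) _
  · intro π i
    have h1 : e.symm (θ π i) = TreeNode.permuteLeaves (Pi.mulSingle i₀ π) (e.symm i) :=
      e.symm_apply_apply _
    have : ∀ w : TreeLeaf k, w = TreeNode.permuteLeaves (Pi.mulSingle i₀ π) (e.symm i) → ∀ hw,
        w.1.path i₀ hw = π (f i) := by
      rintro w rfl _
      change (Pi.mulSingle i₀ π : ∀ i, Equiv.Perm (Fin (k i))) i₀ _ = _
      rw [Pi.mulSingle_eq_same]
    exact this _ h1 _

/-- With `X = K ^ (1 / r)` take `v` about `X / (16 * m)`. Then `(4 * v) ^ r ≤ K / (4 * m) ^ r`.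
Since `X ≥ (32 * m) ^ 2`, `v` is at least both `X / (32 * m)` and the square root of `X`, so `(2 *
v).factorial ≥ v ^ v` is at least `K ^ (X / (64 * m * r))`. -/
theorem exists_two_rpow_le_factorial {m r K : ℕ} (hm : 1 ≤ m) (hr : 1 ≤ r)
    (hK : ((32 * m) ^ 2) ^ r ≤ K) : ∃ v : ℕ, 1 ≤ v ∧ 4 * m * (4 * v) ^ r ≤ K ∧
      (2 : ℝ) ^ (1 / (64 * m * r : ℝ) * ((K : ℝ) ^ (1 / (r : ℝ)) * Real.logb 2 K)) ≤
        ((2 * v).factorial : ℝ) := by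
  have hK0 : (0 : ℝ) < K := by
    have : 0 < ((32 * m) ^ 2) ^ r := by positivity
    exact_mod_cast this.trans_le hK
  have hr0 : (0 : ℝ) < r := by exact_mod_cast hr
  have hm0 : (1 : ℝ) ≤ m := by exact_mod_cast hm
  set X : ℝ := (K : ℝ) ^ (1 / (r : ℝ)) with hX
  have hX0 : 0 < X := Real.rpow_pos_of_pos hK0 _
  have hXr : X ^ r = K := by
    rw [hX, ← Real.rpow_natCast, ← Real.rpow_mul hK0.le, one_div_mul_cancel hr0.ne', Real.rpow_one]
  have hXm : (32 * m : ℝ) ^ 2 ≤ X := by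
    refine le_of_pow_le_pow_left₀ (by omega : r ≠ 0) hX0.le ?_
    rw [hXr]
    exact_mod_cast hK
  have hX32 : 32 * (m : ℝ) ≤ X := by nlinarith
  have hfl := Nat.floor_le (show 0 ≤ X / (16 * m) by positivity)
  have hfl' := Nat.lt_floor_add_one (X / (16 * m))
  set v := ⌊X / (16 * m)⌋₊
  have hvle : X / (32 * m) ≤ v := by
    have h1 : X / (16 * m) = X / (32 * m) + X / (32 * m) := by field_simp; norm_num
    have h2 : 1 ≤ X / (32 * m) := (one_le_div (by positivity)).2 hX32
    linarith
  have hv1 : (1 : ℝ) ≤ v := le_trans ((one_le_div (by positivity)).2 hX32) hvle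
  refine ⟨v, by exact_mod_cast hv1, ?_, ?_⟩
  · have h1 : (4 * v : ℝ) ≤ X / (4 * m) := by
      have : X / (16 * m) * 4 = X / (4 * m) := by field_simp; norm_num
      linarith
    have h2 : (4 * m * (4 * v) ^ r : ℝ) ≤ K := by
      calc (4 * m * (4 * v) ^ r : ℝ) ≤ 4 * m * (X / (4 * m)) ^ r := by gcongr
        _ = 4 * m * K / (4 * m) ^ r := by rw [div_pow, hXr, mul_div_assoc]
        _ ≤ K := by
          rw [div_le_iff₀ (by positivity), mul_comm]
          gcongr
          exact le_self_pow₀ (by linarith) (by omega)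
    exact_mod_cast h2
  · have hsqrt : X ^ (1 / 2 : ℝ) ≤ v := by
      refine le_trans ?_ hvle
      rw [← Real.sqrt_eq_rpow, le_div_iff₀ (by positivity)]
      have h1 : 32 * (m : ℝ) ≤ √X := Real.le_sqrt_of_sq_le hXm
      nlinarith [Real.mul_self_sqrt hX0.le, Real.sqrt_nonneg X]
    have hK1 : (K : ℝ) = (2 : ℝ) ^ Real.logb 2 K := by
      rw [Real.rpow_logb (by norm_num) (by norm_num) hK0]
    calc (2 : ℝ) ^ (1 / (64 * m * r : ℝ) * (X * Real.logb 2 K))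
        = (X ^ (1 / 2 : ℝ)) ^ (X / (32 * m)) := by
          rw [← Real.rpow_mul hX0.le, hX, ← Real.rpow_mul hK0.le, ← hX]
          conv_rhs => rw [hK1]
          rw [← Real.rpow_mul (by norm_num)]
          congr 1
          field_simp
          ring
      _ ≤ (v : ℝ) ^ (X / (32 * m)) := by gcongr
      _ ≤ (v : ℝ) ^ (v : ℝ) := Real.rpow_le_rpow_of_exponent_le hv1 hvle
      _ = ((v ^ v : ℕ) : ℝ) := by rw [Real.rpow_natCast]; push_cast; rfl
      _ ≤ ((2 * v).factorial : ℝ) := by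
          have := Nat.factorial_mul_pow_sub_le_factorial (show v ≤ 2 * v by omega)
          rw [show 2 * v - v = v by omega] at this
          exact_mod_cast (Nat.le_mul_of_pos_left _ (Nat.factorial_pos v)).trans this

/-! ### A depth-two representation of `AND` by modular sums -/

section DepthTwo

theorem sum_choose_mul_choose (w N : ℕ) :
    ∑ j ∈ Finset.range (w + 1), w.choose j * N.choose j = (w + N).choose N := by
  rw [← Nat.choose_symm_add, Nat.add_choose_eq, ← Finset.Nat.sum_antidiagonal_swap,
    Finset.Nat.sum_antidiagonal_eq_sum_range_succ_mk]
  refine Finset.sum_congr rfl fun j hj => ?_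
  simp only [Prod.fst_swap, Prod.snd_swap]
  rw [Nat.choose_symm (Finset.mem_range_succ_iff.1 hj)]

theorem sum_powerset_choose_card {V : Type*} (Z : Finset V) (N : ℕ) :
    ∑ S ∈ Z.powerset, N.choose S.card = (Z.card + N).choose N := by
  rw [Finset.sum_powerset_apply_card (fun j => N.choose j)]
  simp only [smul_eq_mul, sum_choose_mul_choose]

/-- Lucas: all `e` base-`p` digits of `p ^ e - 1` equal `p - 1`, so the coefficient survives modulo
`p` only if the `e` lowest digits of the upper entry are also `p - 1`, that is, if `p ^ e ∣ w`. -/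
theorem choose_add_pow_sub_one_modEq {p : ℕ} (hp : p.Prime) (e w : ℕ) :
    (w + (p ^ e - 1)).choose (p ^ e - 1) ≡ (if p ^ e ∣ w then 1 else 0) [MOD p] := by
  have : Fact p.Prime := ⟨hp⟩
  induction e generalizing w with
  | zero => simp; rfl
  | succ e ih =>
    have hpos : 0 < p ^ e := Nat.pow_pos hp.pos
    have hp2 := hp.two_le
    have hk : p ^ (e + 1) - 1 = p * (p ^ e - 1) + (p - 1) := by
      rw [pow_succ', Nat.mul_sub, mul_one]
      have : p ≤ p * p ^ e := Nat.le_mul_of_pos_right _ hpos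
      omega
    refine (Choose.choose_modEq_choose_mod_mul_choose_div_nat (p := p)).trans ?_
    have hk1 : (p ^ (e + 1) - 1) % p = p - 1 := by
      rw [hk, Nat.mul_add_mod, Nat.mod_eq_of_lt (by omega)]
    have hk2 : (p ^ (e + 1) - 1) / p = p ^ e - 1 := by
      rw [hk, Nat.mul_add_div hp.pos, Nat.div_eq_of_lt (by omega), add_zero]
    by_cases hpw : p ∣ w
    · obtain ⟨w, rfl⟩ := hpw
      have hn : p * w + (p ^ (e + 1) - 1) = p * (w + (p ^ e - 1)) + (p - 1) := by rw [hk]; ring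
      have hn1 : (p * w + (p ^ (e + 1) - 1)) % p = p - 1 := by
        rw [hn, Nat.mul_add_mod, Nat.mod_eq_of_lt (by omega)]
      have hn2 : (p * w + (p ^ (e + 1) - 1)) / p = w + (p ^ e - 1) := by
        rw [hn, Nat.mul_add_div hp.pos, Nat.div_eq_of_lt (by omega), add_zero]
      rw [hk1, hk2, hn1, hn2, Nat.choose_self, one_mul, pow_succ']
      simp only [Nat.mul_dvd_mul_iff_left hp.pos]
      exact ih w
    · have hnd : ¬ p ^ (e + 1) ∣ w := fun h => hpw ((dvd_pow_self p (by omega)).trans h)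
      rw [if_neg hnd, hk1]
      have hlt : (w + (p ^ (e + 1) - 1)) % p < p - 1 := by
        have h0 : w % p ≠ 0 := fun h => hpw (Nat.dvd_of_mod_eq_zero h)
        have hw := Nat.mod_add_div w p
        have : w + (p ^ (e + 1) - 1) = p * (w / p + (p ^ e - 1) + 1) + (w % p - 1) := by
          rw [hk, mul_add, mul_add]
          omega
        rw [this, Nat.mul_add_mod]
        have := Nat.mod_lt w hp.pos
        rw [Nat.mod_eq_of_lt (by omega)]
        omega
      rw [Nat.choose_eq_zero_of_lt hlt, zero_mul]

open Classical in
/-- Linear forms on `ZMod q ^ S`, averaged, detect the zero vector. -/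
theorem sum_indicator_linear_forms {V : Type*} [Fintype V] {q : ℕ} [NeZero q] [Nontrivial (ZMod q)]
    (S : Finset V) (y : V → Bool) :
    ∑ a ∈ ({a | ∀ v ∉ S, a v = 0} : Finset (V → ZMod q)),
      ((if ∑ v ∈ S, a v * ((y v).toNat : ZMod q) = 0 then 1 else 0) -
        (if ∑ v ∈ S, a v * ((y v).toNat : ZMod q) = 1 then 1 else 0) : ℤ) =
      if ∀ v ∈ S, y v = false then (q : ℤ) ^ S.card else 0 := by
  split_ifs with h
  · have h1 : ∀ a : V → ZMod q, ∑ v ∈ S, a v * ((y v).toNat : ZMod q) = 0 := fun a =>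
      Finset.sum_eq_zero fun v hv => by simp [h v hv]
    simp only [h1, if_true, zero_ne_one, if_false, sub_zero, Finset.sum_const, nsmul_eq_mul, mul_one]
    have h2 : ({a | ∀ v ∉ S, a v = 0} : Finset (V → ZMod q)) =
        Fintype.piFinset (fun v => if v ∈ S then Finset.univ else {0}) := by
      ext a
      simp only [Finset.mem_filter, Finset.mem_univ, true_and, Fintype.mem_piFinset]
      refine forall_congr' fun v => ?_
      by_cases hv : v ∈ S <;> simp [hv]
    rw [h2, Fintype.card_piFinset]
    have h3 : ∀ v, (if v ∈ S then (Finset.univ : Finset (ZMod q)) else {0}).card =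
        if v ∈ S then q else 1 := fun v => by split_ifs <;> simp [ZMod.card]
    simp only [h3]
    rw [Finset.prod_ite_mem, Finset.univ_inter, Finset.prod_const]
    push_cast
    rfl
  · push Not at h
    obtain ⟨w, hw, hyw⟩ := h
    rw [Finset.sum_sub_distrib, sub_eq_zero]
    -- If `y w` is true, adding the unit vector at `w` raises the value of a form by one, which
    -- matches the forms of value `0` with those of value `1`.
    refine Finset.sum_bij' (fun a _ => a + Pi.single w 1) (fun a _ => a - Pi.single w 1)
      ?_ ?_ ?_ ?_ ?_
    · intro a ha
      simp only [Finset.mem_filter, Finset.mem_univ, true_and, Pi.add_apply] at ha ⊢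
      intro v hv
      rw [ha v hv, Pi.single_eq_of_ne (by rintro rfl; exact hv hw), add_zero]
    · intro a ha
      simp only [Finset.mem_filter, Finset.mem_univ, true_and, Pi.sub_apply] at ha ⊢
      intro v hv
      rw [ha v hv, Pi.single_eq_of_ne (by rintro rfl; exact hv hw), sub_zero]
    · intro a _; simp
    · intro a _; simp
    · intro a _
      have : ∑ v ∈ S, (a + Pi.single w 1 : V → ZMod q) v * ((y v).toNat : ZMod q) =
          ∑ v ∈ S, a v * ((y v).toNat : ZMod q) + 1 := by
        simp only [Pi.add_apply, add_mul, Finset.sum_add_distrib]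
        congr 1
        rw [Finset.sum_eq_single w]
        · simp [Bool.eq_true_of_not_eq_false hyw]
        · intro v _ hv
          rw [Pi.single_eq_of_ne hv, zero_mul]
        · exact fun h => absurd hw h
      rw [this]
      simp only [add_eq_right]

/-- Look modulo the full power of `p` in `m`: it divides `m / p'` for every other prime `p'`, while
`m / p` lacks exactly one factor `p`. -/
theorem sum_div_mul_eq_zero_iff {m : ℕ} (hm : m ≠ 0) (T : m.primeFactors → ℤ) :
    (∑ p : m.primeFactors, ((m / p.1 : ℕ) : ZMod m) * (T p : ZMod m)) = 0 ↔ ∀ p, (p.1 : ℤ) ∣ T p := by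
  constructor
  · intro h p
    have hp := Nat.prime_of_mem_primeFactors p.2
    have hpm := Nat.dvd_of_mem_primeFactors p.2
    have h1 : ((∑ p : m.primeFactors, ((m / p.1 : ℕ) : ℤ) * T p : ℤ) : ZMod m) = 0 := by
      simp only [Int.cast_sum, Int.cast_mul, Int.cast_natCast]
      exact h
    rw [ZMod.intCast_zmod_eq_zero_iff_dvd] at h1
    have h2 : ((p.1 ^ m.factorization p.1 : ℕ) : ℤ) ∣ ((m / p.1 : ℕ) : ℤ) * T p := by
      rw [← Finset.add_sum_erase _ _ (Finset.mem_univ p)] at h1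
      refine (dvd_add_left (Finset.dvd_sum fun p' hp' => Dvd.dvd.mul_right ?_ _)).1
        ((Int.natCast_dvd_natCast.2 (Nat.ordProj_dvd m p.1)).trans h1)
      rw [Int.natCast_dvd_natCast]
      have hne : p.1 ≠ p'.1 := fun h => (Finset.ne_of_mem_erase hp') (Subtype.ext h.symm)
      have hcop : (p.1 ^ m.factorization p.1).Coprime p'.1 :=
        Nat.Coprime.pow_left _ ((Nat.coprime_primes hp (Nat.prime_of_mem_primeFactors p'.2)).2 hne)
      refine hcop.dvd_of_dvd_mul_left ?_
      rw [Nat.mul_div_cancel' (Nat.dvd_of_mem_primeFactors p'.2)]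
      exact Nat.ordProj_dvd m p.1
    have hf := hp.factorization_pos_of_dvd hm hpm
    have h3 : m / p.1 = p.1 ^ (m.factorization p.1 - 1) * (m / p.1 ^ m.factorization p.1) := by
      refine Nat.div_eq_of_eq_mul_right hp.pos ?_
      rw [← mul_assoc, ← pow_succ', Nat.sub_add_cancel hf, Nat.ordProj_mul_ordCompl_eq_self]
    obtain ⟨f, hf'⟩ : ∃ f, m.factorization p.1 = f + 1 := ⟨m.factorization p.1 - 1, by omega⟩
    have hnd := Nat.coprime_ordCompl hp hm
    rw [h3, hf', Nat.add_sub_cancel, ← hf', Nat.cast_mul, mul_assoc] at h2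
    rw [hf', pow_succ, Nat.cast_mul] at h2
    rw [hf', pow_succ] at hnd
    have h4 := Int.dvd_of_mul_dvd_mul_left (by exact_mod_cast pow_ne_zero _ hp.ne_zero) h2
    exact IsCoprime.dvd_of_dvd_mul_left (Nat.isCoprime_iff_coprime.2 hnd) h4
  · intro h
    refine Finset.sum_eq_zero fun p _ => ?_
    obtain ⟨s, hs⟩ := h p
    rw [hs, Int.cast_mul, ← mul_assoc, Int.cast_natCast, ← Nat.cast_mul,
      Nat.div_mul_cancel (Nat.dvd_of_mem_primeFactors p.2), ZMod.natCast_self, zero_mul]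

/-- The coefficient of the indicator of a linear form on `s` variables; `u` stands for an inverse
modulo `p` of the modulus of the linear form, and `P` for a power of `p`. -/
def formCoeff (P u s : ℕ) (t : Bool) : ℤ :=
  (P - 1).choose s * u ^ s * (if t then -1 else 1)

open Classical in
-- Modulo `p` the factor `u ^ s` cancels the `q ^ s` produced by averaging. Over all sets `S` the
-- sum would be the indicator of `p ^ e ∣ Z.card`, with `Z` the set of false children. Sets of size
-- at least `p ^ e` have coefficient zero. The empty set, whose gate would have no incoming wires,
-- is left out; it contributes `1`, so what remains vanishes exactly when the indicator is `1`.
theorem dvd_sum_formCoeff_iff {V : Type*} [Fintype V] {p e q u : ℕ} (hp : p.Prime)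
    [NeZero q] [Nontrivial (ZMod q)] (hu : u * q ≡ 1 [MOD p]) (Ch : Finset V) (y : V → Bool) :
    (p : ℤ) ∣ ∑ S ∈ Ch.powerset with S.Nonempty ∧ S.card < p ^ e,
      ∑ a ∈ ({a | ∀ v ∉ S, a v = 0} : Finset (V → ZMod q)), ∑ t : Bool,
        formCoeff (p ^ e) u S.card t *
          (if ∑ v ∈ S, a v * ((y v).toNat : ZMod q) = (t.toNat : ZMod q) then 1 else 0) ↔
      p ^ e ∣ ({v ∈ Ch | y v = false} : Finset V).card := by
  have hinner : ∀ S : Finset V, ∑ a ∈ ({a | ∀ v ∉ S, a v = 0} : Finset (V → ZMod q)), ∑ t : Bool,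
        formCoeff (p ^ e) u S.card t *
          (if ∑ v ∈ S, a v * ((y v).toNat : ZMod q) = (t.toNat : ZMod q) then 1 else 0) =
      (p ^ e - 1).choose S.card * u ^ S.card *
        (if ∀ v ∈ S, y v = false then (q : ℤ) ^ S.card else 0) := by
    intro S
    rw [← sum_indicator_linear_forms, Finset.mul_sum]
    refine Finset.sum_congr rfl fun a _ => ?_
    simp only [formCoeff, Fintype.sum_bool, Bool.toNat_true, Bool.toNat_false, Nat.cast_one,
      Nat.cast_zero, if_true, Bool.false_eq_true, if_false]
    ring
  simp only [hinner]
  set Z : Finset V := {v ∈ Ch | y v = false} with hZ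
  have huq : ∀ s : ℕ, ((u : ZMod p) ^ s) * (q : ZMod p) ^ s = 1 := by
    intro s
    have := (ZMod.natCast_eq_natCast_iff _ _ _).2 hu
    push_cast at this
    rw [← mul_pow, this, one_pow]
  have hsum : ((∑ S ∈ Ch.powerset with S.Nonempty ∧ S.card < p ^ e,
      (p ^ e - 1).choose S.card * u ^ S.card *
        (if ∀ v ∈ S, y v = false then (q : ℤ) ^ S.card else 0) : ℤ) : ZMod p) + 1 =
      ((∑ S ∈ Z.powerset, (p ^ e - 1).choose S.card : ℕ) : ZMod p) := by
    rw [← Finset.add_sum_erase _ _ (Finset.empty_mem_powerset Z)]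
    simp only [Finset.card_empty, Nat.choose_zero_right, Nat.cast_add, Nat.cast_one]
    rw [add_comm]
    congr 1
    push_cast
    have hterm : ∀ S ∈ ({S ∈ Ch.powerset | S.Nonempty ∧ S.card < p ^ e} : Finset (Finset V)),
        (((p ^ e - 1).choose S.card : ZMod p) * (u : ZMod p) ^ S.card *
          (if ∀ v ∈ S, y v = false then (q : ZMod p) ^ S.card else 0)) =
        if S ∈ Z.powerset.erase ∅ then ((p ^ e - 1).choose S.card : ZMod p) else 0 := by
      intro S hS
      simp only [Finset.mem_filter, Finset.mem_powerset] at hS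
      have hiff : S ∈ Z.powerset.erase ∅ ↔ ∀ v ∈ S, y v = false := by
        simp only [Finset.mem_erase, Finset.mem_powerset, ← Finset.nonempty_iff_ne_empty, hZ,
          Finset.subset_iff, Finset.mem_filter]
        exact ⟨fun h v hv => (h.2 hv).2, fun h => ⟨hS.2.1, fun v hv => ⟨hS.1 hv, h v hv⟩⟩⟩
      by_cases hS' : S ∈ Z.powerset.erase ∅
      · rw [if_pos hS', if_pos (hiff.1 hS'), mul_assoc, huq, mul_one]
      · rw [if_neg hS', if_neg (fun h => hS' (hiff.2 h)), mul_zero]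
    rw [Finset.sum_congr rfl hterm, Finset.sum_ite_mem]
    refine Finset.sum_subset Finset.inter_subset_right fun S hS hS' => ?_
    rw [Nat.choose_eq_zero_of_lt, Nat.cast_zero]
    by_contra hc
    refine hS' (Finset.mem_inter.2 ⟨?_, hS⟩)
    simp only [Finset.mem_erase, Finset.mem_powerset, ← Finset.nonempty_iff_ne_empty] at hS
    have : 0 < p ^ e := Nat.pow_pos hp.pos
    exact Finset.mem_filter.2 ⟨Finset.mem_powerset.2 (hS.2.trans (Finset.filter_subset _ _)),
      hS.1, by omega⟩
  have : Fact p.Prime := ⟨hp⟩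
  rw [← ZMod.intCast_zmod_eq_zero_iff_dvd, ← add_left_inj (1 : ZMod p), hsum,
    sum_powerset_choose_card,
    (ZMod.natCast_eq_natCast_iff _ _ _).2 (choose_add_pow_sub_one_modEq hp e Z.card)]
  split_ifs with h <;> simp [h]

end DepthTwo

/-! ### Counting nodes and children of the tree -/

namespace TreeNode

variable {h : ℕ} {k : Fin h → ℕ}

theorem eq_of_path_eq {u v : TreeNode k} (hl : u.level = v.level)
    (hp : ∀ i hu hv, u.path i hu = v.path i hv) : u = v := by
  obtain ⟨l, hl1, p⟩ := u
  obtain ⟨l', hl2, p'⟩ := v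
  obtain rfl : l = l' := hl
  congr 1
  funext i hi
  exact hp i hi hi

theorem le_maxBlock (k : Fin h → ℕ) (i : Fin h) : k i ≤ maxBlock k :=
  Finset.le_sup (f := k) (Finset.mem_univ i)

/-- Encoding of a node by its level and its path, padded by zeros. -/
def encode (v : TreeNode k) : Fin (h + 1) × (Fin h → Fin (maxBlock k + 1)) :=
  (⟨v.level, Nat.lt_succ_of_le v.level_le⟩, fun i => if hi : v.level ≤ i then
    ⟨v.path i hi, ((v.path i hi).2.trans_le (le_maxBlock k i)).trans (Nat.lt_succ_self _)⟩ else 0)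

theorem encode_injective : Function.Injective (encode (k := k)) := by
  intro u v huv
  simp only [encode, Prod.mk.injEq, Fin.mk.injEq] at huv
  refine eq_of_path_eq huv.1 fun i hu hv => ?_
  have := congrFun huv.2 i
  simp only [hu, hv, dif_pos, Fin.mk.injEq] at this
  exact Fin.ext this

noncomputable instance : Fintype (TreeNode k) :=
  have := Finite.of_injective _ (encode_injective (k := k))
  Fintype.ofFinite _

theorem card_le : Fintype.card (TreeNode k) ≤ (h + 1) * (maxBlock k + 1) ^ h := by
  have := Fintype.card_le_of_injective _ (encode_injective (k := k))
  simpa using this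

theorem HasChild.level_eq {u v : TreeNode k} (huv : u.HasChild v) : u.level = v.level + 1 := huv.1

theorem exists_hasChild (hk : ∀ i, 0 < k i) {u : TreeNode k} (hu : u.level ≠ 0) :
    ∃ v, u.HasChild v := by
  have hle := u.level_le
  refine ⟨⟨u.level - 1, by omega, fun i _ => if hi : u.level ≤ i then u.path i hi else ⟨0, hk i⟩⟩,
    (Nat.sub_add_cancel (Nat.pos_of_ne_zero hu)).symm, fun i hi => (dif_pos hi).symm⟩

theorem exists_hasChild_of_lt {v : TreeNode k} (hv : v.level < h) : ∃ u, HasChild u v :=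
  ⟨⟨v.level + 1, hv, fun i hi => v.path i (by omega)⟩, rfl, fun _ _ => rfl⟩

/-- A node on level `0` as a leaf. -/
def toLeaf (v : TreeNode k) (hv : v.level = 0) : TreeLeaf k := ⟨v, hv⟩

/-- The root of the tree. -/
def top (k : Fin h → ℕ) : TreeNode k := ⟨h, le_rfl, fun i hi => absurd i.2 (not_lt.2 hi)⟩

theorem eq_top_of_level {v : TreeNode k} (hv : v.level = h) : v = top k :=
  eq_of_path_eq hv fun i hu _ => absurd i.2 (by omega)

open Classical in
theorem card_children_le (u : TreeNode k) :
    ({v | u.HasChild v} : Finset (TreeNode k)).card ≤ maxBlock k := by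
  by_cases hu : u.level = 0
  · rw [Finset.card_eq_zero.2]
    · exact Nat.zero_le _
    · ext v
      simp only [Finset.mem_filter, Finset.mem_univ, true_and, Finset.notMem_empty, iff_false]
      intro hv
      have := hv.level_eq
      omega
  have hlt : u.level - 1 < h := by have := u.level_le; omega
  have hle : ∀ {v}, u.HasChild v → v.level ≤ ((⟨u.level - 1, hlt⟩ : Fin h) : ℕ) := fun hv => by
    have := hv.level_eq
    change _ ≤ u.level - 1
    omega
  have := Finset.card_le_card_of_injOn (s := ({v | u.HasChild v} : Finset (TreeNode k)))
    (t := Finset.range (k ⟨u.level - 1, hlt⟩))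
    (fun v => if hv : v.level ≤ ((⟨u.level - 1, hlt⟩ : Fin h) : ℕ) then
      (v.path ⟨u.level - 1, hlt⟩ hv : ℕ) else 0) ?_ ?_
  · rw [Finset.card_range] at this
    exact this.trans (le_maxBlock k _)
  · intro v hv
    simp only [Finset.coe_filter, Finset.mem_univ, true_and, Set.mem_ofPred_eq] at hv
    simp only [dif_pos (hle hv), Finset.coe_range, Set.mem_Iio, Fin.is_lt]
  · intro v hv w hw hvw
    simp only [Finset.coe_filter, Finset.mem_univ, true_and, Set.mem_ofPred_eq] at hv hw
    simp only [dif_pos (hle hv), dif_pos (hle hw)] at hvw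
    refine eq_of_path_eq (by have := hv.level_eq; have := hw.level_eq; omega) fun i hi hi' => ?_
    by_cases hi2 : u.level ≤ i
    · rw [← hv.2 i hi2, ← hw.2 i hi2]
    · have : i = ⟨u.level - 1, hlt⟩ := Fin.ext (by
        have := hv.level_eq
        change (i : ℕ) = u.level - 1
        omega)
      subst this
      exact Fin.ext hvw

end TreeNode

theorem ModCircuit.height_eq_of_graded {m n : ℕ} (C : ModCircuit m n) (rank : C.Gate → ℕ)
    (hrank : ∀ g g', 0 < C.wires g g' → rank g' = rank g + 1)
    (hinput : ∀ g i, C.label g = Sum.inl i → rank g = 0) (g : C.Gate) : C.height g = rank g := by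
  induction g using C.acyclic.induction with
  | _ g ih =>
    unfold height at ih ⊢
    rw [WellFounded.fix_eq]
    have h1 : ∀ g', (if _ : 0 < C.wires g' g then C.height g' + 1 else 0) =
        if 0 < C.wires g' g then rank g else 0 := by
      intro g'
      by_cases hw : 0 < C.wires g' g
      · rw [dif_pos hw, if_pos hw, hrank _ _ hw]
        exact congrArg (· + 1) (ih g' hw)
      · rw [dif_neg hw, if_neg hw]
    refine (Finset.sup_congr rfl fun g' _ => h1 g').trans ?_
    refine le_antisymm (Finset.sup_le fun g' _ => by split_ifs <;> simp) ?_
    by_cases hg : ∀ g', C.wires g' g = 0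
    · obtain ⟨i, hi⟩ := (C.source_iff_input g).1 hg
      rw [hinput g i hi]
      exact Nat.zero_le _
    · push Not at hg
      obtain ⟨g', hg'⟩ := hg
      refine le_trans ?_ (Finset.le_sup (Finset.mem_univ g'))
      rw [if_pos (Nat.pos_of_ne_zero hg')]

/-! ### The circuit for the upper bound -/

/-- Parameters of the construction: for each prime divisor `p` of `m` another prime divisor
`modulus p`, an inverse of it modulo `p`, and the exponent of a power of `p`. -/
structure AndParams (m : ℕ) where
  modulus : ℕ → ℕ
  exponent : ℕ → ℕ
  inverse : ℕ → ℕ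
  prime_modulus : ∀ p, (modulus p).Prime
  modulus_dvd : ∀ p, modulus p ∣ m
  inverse_mul : ∀ p ∈ m.primeFactors, inverse p * modulus p ≡ 1 [MOD p]
  exponent_ne_zero : ∀ p, exponent p ≠ 0
  ne_zero : m ≠ 0

namespace AndParams

variable {m n h : ℕ} (A : AndParams m) (k : Fin h → ℕ)

instance (p : ℕ) : Fact (A.modulus p).Prime := ⟨A.prime_modulus p⟩

instance (p : ℕ) : NeZero (A.modulus p) := ⟨(A.prime_modulus p).ne_zero⟩

/-- The gates of the lower layer at the inner nodes `u` of the tree: they evaluate a linear form `a`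
modulo `A.modulus p` on a set `S` of children of `u` and compare the result with the bit `t`. -/
def FormGate : Type :=
  Σ p : m.primeFactors, {x : TreeNode k × Finset (TreeNode k) ×
      (TreeNode k → ZMod (A.modulus p)) × Bool //
    (∀ v ∈ x.2.1, x.1.HasChild v) ∧ x.2.1.Nonempty ∧ x.2.1.card < p.1 ^ A.exponent p ∧
      ∀ v ∉ x.2.1, x.2.2.1 v = 0}

open Classical in
noncomputable instance : Fintype (A.FormGate k) :=
  inferInstanceAs (Fintype (Σ p : m.primeFactors, {x : TreeNode k × Finset (TreeNode k) ×
      (TreeNode k → ZMod (A.modulus p)) × Bool //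
    (∀ v ∈ x.2.1, x.1.HasChild v) ∧ x.2.1.Nonempty ∧ x.2.1.card < p.1 ^ A.exponent p ∧
      ∀ v ∉ x.2.1, x.2.2.1 v = 0}))

namespace FormGate

variable {A k} (g : A.FormGate k)

/-- The node to which the gate belongs. -/
def node : TreeNode k := g.2.1.1

/-- The set of children on which the linear form lives. -/
def supp : Finset (TreeNode k) := g.2.1.2.1

/-- The coefficients of the linear form. -/
def form : TreeNode k → ZMod (A.modulus g.1) := g.2.1.2.2.1

/-- The value that is tested. -/
def bit : Bool := g.2.1.2.2.2

/-- The weight of the gate in the modular sum at its node. -/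
def weight : ZMod m :=
  ((m / g.1.1 : ℕ) : ZMod m) *
    (formCoeff (g.1.1 ^ A.exponent g.1) (A.inverse g.1) g.supp.card g.bit : ℤ)

/-- The action of tree automorphisms on the gates. -/
def map (φ : (TreeNode.HasChild (k := k)) ≃r (TreeNode.HasChild (k := k))) : A.FormGate k :=
  ⟨g.1, (φ g.node, g.supp.map φ.toEquiv.toEmbedding, fun v => g.form (φ.symm v), g.bit), by
    obtain ⟨h1, h2, h3, h4⟩ := g.2.2
    refine ⟨?_, ?_, ?_, ?_⟩
    · intro v hv
      obtain ⟨w, hw, rfl⟩ := Finset.mem_map.1 hv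
      exact φ.map_rel_iff.2 (h1 w hw)
    · exact h2.map
    · rw [Finset.card_map]
      exact h3
    · intro v hv
      refine h4 _ fun hc => hv (Finset.mem_map.2 ⟨_, hc, φ.apply_symm_apply v⟩)⟩

theorem map_symm_map (φ : (TreeNode.HasChild (k := k)) ≃r (TreeNode.HasChild (k := k))) :
    (g.map φ).map φ.symm = g := by
  obtain ⟨p, ⟨u, S, a, t⟩, hg⟩ := g
  simp only [map, node, supp, form, bit, RelIso.symm_apply_apply, RelIso.symm_symm,
    Finset.map_map]
  congr 2
  simp only [Prod.mk.injEq, true_and]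
  refine ⟨?_, ?_⟩
  · convert Finset.map_refl
    ext v
    simp
  · simp

end FormGate

open Classical in
/-- The wires of the circuit. -/
noncomputable def wires : TreeNode k ⊕ A.FormGate k → TreeNode k ⊕ A.FormGate k → ℕ
  -- Adding the modulus, here and in the next case, does not change the sums but keeps the wire
  -- present when the coefficient is zero.
  | Sum.inl v, Sum.inr g => if v ∈ g.supp then (g.form v).val + A.modulus g.1 else 0
  | Sum.inr g, Sum.inl u => if g.node = u then g.weight.val + m else 0
  | Sum.inl _, Sum.inl _ => 0
  | Sum.inr _, Sum.inr _ => 0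

/-- The grading of the gates by depth. -/
def rank : TreeNode k ⊕ A.FormGate k → ℕ
  | Sum.inl v => 2 * v.level
  | Sum.inr g => 2 * g.node.level - 1

variable {k}

theorem rank_eq_of_wires_pos {g g' : TreeNode k ⊕ A.FormGate k} (hw : 0 < A.wires k g g') :
    A.rank k g' = A.rank k g + 1 := by
  rcases g with v | g <;> rcases g' with u | g'
  · simp [wires] at hw
  · simp only [wires] at hw
    split_ifs at hw with hv
    · have := (g'.2.2.1 v hv).level_eq
      simp only [rank, FormGate.node]
      omega
    · exact absurd hw (lt_irrefl _)
  · simp only [wires] at hw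
    split_ifs at hw with hv
    · subst hv
      obtain ⟨v, hv⟩ := g.2.2.2.1
      have := (g.2.2.1 v hv).level_eq
      simp only [rank, FormGate.node]
      omega
    · exact absurd hw (lt_irrefl _)
  · simp [wires] at hw

/-- Every edge of the tree is used by some gate, so inner nodes have incoming wires and nodes below
the root have outgoing ones. Nonzero exponents make room for singleton supports; `A.modulus 0` is
just some prime divisor of `m`. -/
theorem exists_formGate_singleton {u v : TreeNode k} (huv : u.HasChild v) :
    ∃ g : A.FormGate k, g.node = u ∧ g.supp = {v} := by
  have hp : A.modulus 0 ∈ m.primeFactors :=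
    Nat.mem_primeFactors.2 ⟨A.prime_modulus 0, A.modulus_dvd 0, A.ne_zero⟩
  exact ⟨⟨⟨_, hp⟩, (u, {v}, fun _ => 0, true), by simpa using huv, by simp,
    by simpa using Nat.one_lt_pow (A.exponent_ne_zero _) (A.prime_modulus 0).one_lt, by simp⟩, rfl, rfl⟩

/-- The labels of the gates. -/
noncomputable def label (e : TreeLeaf k ≃ Fin n) :
    TreeNode k ⊕ A.FormGate k → Fin n ⊕ Set (ZMod m)
  | Sum.inl v => if hv : v.level = 0 then Sum.inl (e (v.toLeaf hv)) else Sum.inr {0}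
  | Sum.inr g => Sum.inr
      {z | ZMod.castHom (A.modulus_dvd g.1) (ZMod (A.modulus g.1)) z = (g.bit.toNat : ZMod _)}

theorem label_inl_of_eq (e : TreeLeaf k ≃ Fin n) {v : TreeNode k} (hv : v.level = 0) :
    A.label e (Sum.inl v) = Sum.inl (e (v.toLeaf hv)) := dif_pos hv

theorem label_inl_of_ne (e : TreeLeaf k ≃ Fin n) {v : TreeNode k} (hv : v.level ≠ 0) :
    A.label e (Sum.inl v) = Sum.inr {0} := dif_neg hv

theorem label_eq_inl_iff (e : TreeLeaf k ≃ Fin n) (g : TreeNode k ⊕ A.FormGate k) (i : Fin n) :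
    A.label e g = Sum.inl i ↔ g = Sum.inl (e.symm i).1 := by
  rcases g with v | g
  · rw [Sum.inl.injEq]
    by_cases hv : v.level = 0
    · rw [A.label_inl_of_eq e hv, Sum.inl.injEq]
      constructor
      · rintro rfl
        rw [e.symm_apply_apply]
        rfl
      · intro h
        rw [← e.eq_symm_apply]
        exact Subtype.ext h
    · rw [A.label_inl_of_ne e hv]
      simp only [reduceCtorEq, false_iff]
      rintro rfl
      exact hv (e.symm i).2
  · simp [label]

open Classical in
/-- The circuit with one gate for each node of the tree, and linear forms on the children below. -/
noncomputable def circuit (hk : ∀ i, 0 < k i) (e : TreeLeaf k ≃ Fin n) : ModCircuit m n where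
  Gate := TreeNode k ⊕ A.FormGate k
  gateFintype := inferInstance
  label := A.label e
  wires := A.wires k
  root := Sum.inl (TreeNode.top k)
  acyclic := Subrelation.wf (h₂ := (measure (A.rank k)).wf) fun hw => by
    change A.rank k _ < A.rank k _
    rw [A.rank_eq_of_wires_pos hw]
    exact Nat.lt_succ_self _
  source_iff_input := by
    rintro (u | g)
    · constructor
      · intro hw
        by_cases hu : u.level = 0
        · exact ⟨_, A.label_inl_of_eq e hu⟩
        · obtain ⟨v, hv⟩ := TreeNode.exists_hasChild hk hu
          obtain ⟨g, hg, -⟩ := A.exists_formGate_singleton hv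
          have := hw (Sum.inr g)
          simp only [wires, hg, if_true] at this
          have := A.ne_zero
          omega
      · rintro ⟨i, hi⟩ g
        have hu : u.level = 0 := by
          rw [label_eq_inl_iff, Sum.inl.injEq] at hi
          rw [hi]
          exact (e.symm i).2
        by_contra hw
        have := A.rank_eq_of_wires_pos (Nat.pos_of_ne_zero hw)
        simp only [rank, hu] at this
        omega
    · refine ⟨fun hw => ?_, fun ⟨i, hi⟩ => by cases hi⟩
      obtain ⟨v, hv⟩ := g.2.2.2.1
      have := hw (Sum.inl v)
      simp only [wires] at this
      rw [if_pos (by exact hv)] at this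
      have := (A.prime_modulus g.1).pos
      omega
  existsUnique_input i := by
    simp only [label_eq_inl_iff]
    exact ⟨_, rfl, fun _ h => h⟩

end AndParams

theorem ModCircuit.eval_eq_true_iff {m n : ℕ} (C : ModCircuit m n) (x : Fin n → Bool) {g : C.Gate}
    {R : Set (ZMod m)} (h : C.label g = Sum.inr R) : C.eval x g = true ↔
      ((∑ g', C.wires g' g * (C.eval x g').toNat : ℕ) : ZMod m) ∈ R := by
  classical
  rw [C.eval_of_label_inr x h]
  exact decide_eq_true_iff

/-! ### Symmetry, depth and correctness of the circuit -/

namespace AndParams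

variable {m n h : ℕ} (A : AndParams m) {k : Fin h → ℕ}

/-- The action of tree automorphisms on all gates. -/
def mapGates (φ : (TreeNode.HasChild (k := k)) ≃r (TreeNode.HasChild (k := k))) :
    Equiv.Perm (TreeNode k ⊕ A.FormGate k) :=
  Equiv.sumCongr φ.toEquiv
    { toFun := fun g => g.map φ
      invFun := fun g => g.map φ.symm
      left_inv := fun g => g.map_symm_map φ
      right_inv := fun g => g.map_symm_map φ.symm }

theorem isSymmetric_circuit (hk : ∀ i, 0 < k i) (e : TreeLeaf k ≃ Fin n) :
    (A.circuit hk e).IsSymmetric (treeAut k e) := by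
  classical
  rintro π ⟨φ, hφ⟩
  -- An automorphism is only assumed to respect edges. That it keeps leaves and inner nodes apart
  -- follows because every leaf is the image of a leaf, by surjectivity of `π`.
  have hlevel : ∀ v : TreeNode k, (φ v).level = 0 → v.level = 0 := by
    intro v hv
    have h1 := hφ (π⁻¹ (e ((φ v).toLeaf hv)))
    rw [← Equiv.Perm.mul_apply, mul_inv_cancel, Equiv.Perm.one_apply, e.symm_apply_apply] at h1
    rw [← φ.injective h1]
    exact (e.symm _).2
  refine ⟨A.mapGates φ, ?_, ?_, ?_⟩
  · intro g i hg
    obtain rfl := (A.label_eq_inl_iff e g i).1 hg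
    exact (A.label_eq_inl_iff e _ _).2 (congrArg Sum.inl (hφ i))
  · rintro (v | g) R hg
    · change A.label e (Sum.inl v) = _ at hg
      change A.label e (Sum.inl (φ v)) = _
      have hv : v.level ≠ 0 := fun h0 => by rw [A.label_inl_of_eq e h0] at hg; cases hg
      rw [A.label_inl_of_ne e hv] at hg
      rw [A.label_inl_of_ne e fun h0 => hv (hlevel v h0), hg]
    · exact hg
  · rintro (v | g) (u | g')
    · rfl
    · change A.wires k (Sum.inl (φ v)) (Sum.inr (g'.map φ)) = A.wires k (Sum.inl v) (Sum.inr g')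
      have h1 : φ v ∈ (g'.map φ).supp ↔ v ∈ g'.supp := Finset.mem_map' φ.toEquiv.toEmbedding
      have h2 : (g'.map φ).form (φ v) = g'.form v := congrArg g'.form (φ.symm_apply_apply v)
      simp only [wires, h1]
      rw [h2]
      rfl
    · change A.wires k (Sum.inr (g.map φ)) (Sum.inl (φ u)) = A.wires k (Sum.inr g) (Sum.inl u)
      have h1 : (g.map φ).node = φ u ↔ g.node = u := φ.injective.eq_iff
      have h2 : (g.map φ).weight = g.weight := by
        have : (g.map φ).supp.card = g.supp.card := Finset.card_map _
        simp only [FormGate.weight, this]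
        rfl
      simp only [wires, h1, h2]
    · rfl

theorem depth_circuit (hk : ∀ i, 0 < k i) (e : TreeLeaf k ≃ Fin n) :
    (A.circuit hk e).depth = 2 * h := by
  refine ((A.circuit hk e).height_eq_of_graded (A.rank k) (fun _ _ => A.rank_eq_of_wires_pos) ?_ _)
  intro g i hg
  obtain rfl := (A.label_eq_inl_iff e g i).1 hg
  simp only [rank, (e.symm i).2]

theorem rootIsOnlySink_circuit (hk : ∀ i, 0 < k i) (e : TreeLeaf k ≃ Fin n) :
    (A.circuit hk e).RootIsOnlySink := by
  classical
  intro g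
  change (∀ g', A.wires k g g' = 0) ↔ g = Sum.inl (TreeNode.top k)
  constructor
  · intro hg
    rcases g with v | g
    · by_cases hv : v.level < h
      · obtain ⟨u, hu⟩ := TreeNode.exists_hasChild_of_lt hv
        obtain ⟨g, -, hg'⟩ := A.exists_formGate_singleton hu
        have := hg (Sum.inr g)
        simp only [wires, hg', Finset.mem_singleton, if_true] at this
        have := (A.prime_modulus g.1).pos
        omega
      · rw [TreeNode.eq_top_of_level (le_antisymm v.level_le (not_lt.1 hv))]
    · have := hg (Sum.inl g.node)
      simp only [wires, if_true] at this
      have := A.ne_zero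
      omega
  · rintro rfl (u | g)
    · rfl
    · simp only [wires]
      rw [if_neg]
      intro hv
      have h1 := (g.2.2.1 _ hv).level_eq
      have h2 := g.node.level_le
      change g.node.level = h + 1 at h1
      omega

open Classical in
theorem eval_formGate (hk : ∀ i, 0 < k i) (e : TreeLeaf k ≃ Fin n) (x : Fin n → Bool)
    (g : A.FormGate k) : (A.circuit hk e).eval x (Sum.inr g) =
      decide (∑ v ∈ g.supp, g.form v * (((A.circuit hk e).eval x (Sum.inl v)).toNat :
        ZMod (A.modulus g.1)) = (g.bit.toNat : ZMod (A.modulus g.1))) := by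
  rw [(A.circuit hk e).eval_of_label_inr x (g := Sum.inr g) rfl]
  congr 1
  rw [Set.mem_ofPred_eq, map_natCast]
  have : ((∑ g' : TreeNode k ⊕ A.FormGate k, A.wires k g' (Sum.inr g) *
      ((A.circuit hk e).eval x g').toNat : ℕ) : ZMod (A.modulus g.1)) =
      ∑ v ∈ g.supp, g.form v * (((A.circuit hk e).eval x (Sum.inl v)).toNat :
        ZMod (A.modulus g.1)) := by
    rw [Fintype.sum_sum_type]
    simp only [wires, zero_mul, Finset.sum_const_zero, add_zero, ite_mul, Finset.sum_ite_mem,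
      Finset.univ_inter]
    push_cast
    refine Finset.sum_congr rfl fun v _ => ?_
    rw [ZMod.natCast_val, ZMod.cast_id, ZMod.natCast_self, add_zero]
  exact propext (Iff.of_eq (congrArg (· = _) this))

open Classical in
theorem sum_formGate {R : Type*} [AddCommMonoid R] (u : TreeNode k)
    (X : (p : m.primeFactors) → Finset (TreeNode k) → (TreeNode k → ZMod (A.modulus p)) → Bool → R) :
    ∑ g : A.FormGate k, (if g.node = u then X g.1 g.supp g.form g.bit else 0) =
      ∑ p : m.primeFactors, ∑ S ∈ ({v | u.HasChild v} : Finset (TreeNode k)).powerset with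
            S.Nonempty ∧ S.card < p.1 ^ A.exponent p,
          ∑ a ∈ ({a | ∀ v ∉ S, a v = 0} : Finset (TreeNode k → ZMod (A.modulus p))), ∑ t : Bool,
            X p S a t := by
  refine (Fintype.sum_sigma _).trans (Finset.sum_congr rfl fun p _ => ?_)
  let cond : TreeNode k × Finset (TreeNode k) × (TreeNode k → ZMod (A.modulus p)) × Bool → Prop :=
    fun x => (∀ v ∈ x.2.1, x.1.HasChild v) ∧ x.2.1.Nonempty ∧ x.2.1.card < p.1 ^ A.exponent p ∧
      ∀ v ∉ x.2.1, x.2.2.1 v = 0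
  refine (Finset.sum_subtype (p := cond) (Finset.univ.filter cond) (by simp)
    (fun x => if x.1 = u then X p x.2.1 x.2.2.1 x.2.2.2 else 0)).symm.trans ?_
  rw [Finset.sum_filter, Fintype.sum_prod_type, Finset.sum_eq_single u _ (fun h => absurd (Finset.mem_univ u) h)]
  · have hfilter : ({S ∈ ({v | u.HasChild v} : Finset (TreeNode k)).powerset |
        S.Nonempty ∧ S.card < p.1 ^ A.exponent p} : Finset (Finset (TreeNode k))) =
        Finset.univ.filter (fun S => (∀ v ∈ S, u.HasChild v) ∧ S.Nonempty ∧
          S.card < p.1 ^ A.exponent p) := by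
      ext S
      simp [Finset.subset_iff]
    rw [hfilter, Finset.sum_filter, Fintype.sum_prod_type]
    refine Finset.sum_congr rfl fun S _ => ?_
    rw [Fintype.sum_prod_type]
    by_cases hS : (∀ v ∈ S, u.HasChild v) ∧ S.Nonempty ∧ S.card < p.1 ^ A.exponent p
    · rw [if_pos hS, Finset.sum_filter]
      refine Finset.sum_congr rfl fun a _ => ?_
      by_cases ha : ∀ v ∉ S, a v = 0
      · rw [if_pos ha]
        refine Finset.sum_congr rfl fun t _ => ?_
        rw [if_pos ⟨hS.1, hS.2.1, hS.2.2, ha⟩, if_pos rfl]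
      · rw [if_neg ha]
        exact Finset.sum_eq_zero fun t _ => if_neg fun hc => ha hc.2.2.2
    · rw [if_neg hS]
      exact Finset.sum_eq_zero fun a _ => Finset.sum_eq_zero fun t _ =>
        if_neg fun hc => hS ⟨hc.1, hc.2.1, hc.2.2.1⟩
  · intro u' _ hu'
    refine Finset.sum_eq_zero fun x _ => ?_
    rw [if_neg hu', ite_self]

open Classical in
theorem eval_node (hk : ∀ i, 0 < k i) (e : TreeLeaf k ≃ Fin n) (x : Fin n → Bool)
    {u : TreeNode k} (hu : u.level ≠ 0) :
    (A.circuit hk e).eval x (Sum.inl u) = true ↔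
      ∀ p : m.primeFactors, p.1 ^ A.exponent p ∣
        ({v ∈ ({v | u.HasChild v} : Finset (TreeNode k)) |
          (A.circuit hk e).eval x (Sum.inl v) = false} : Finset _).card := by
  have : NeZero m := ⟨A.ne_zero⟩
  rw [(A.circuit hk e).eval_eq_true_iff x (g := Sum.inl u) (A.label_inl_of_ne e hu),
    Set.mem_singleton_iff]
  set y : TreeNode k → Bool := fun v => (A.circuit hk e).eval x (Sum.inl v) with hy
  have key : ((∑ g' : TreeNode k ⊕ A.FormGate k, A.wires k g' (Sum.inl u) *
      ((A.circuit hk e).eval x g').toNat : ℕ) : ZMod m) =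
      ∑ p : m.primeFactors, ((m / p.1 : ℕ) : ZMod m) *
        ((∑ S ∈ ({v | u.HasChild v} : Finset (TreeNode k)).powerset with
            S.Nonempty ∧ S.card < p.1 ^ A.exponent p,
          ∑ a ∈ ({a | ∀ v ∉ S, a v = 0} : Finset (TreeNode k → ZMod (A.modulus p))), ∑ t : Bool,
            formCoeff (p.1 ^ A.exponent p) (A.inverse p) S.card t *
              (if ∑ v ∈ S, a v * ((y v).toNat : ZMod (A.modulus p)) =
                (t.toNat : ZMod (A.modulus p)) then 1 else 0) : ℤ) : ZMod m) := by
    rw [Fintype.sum_sum_type]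
    simp only [wires, zero_mul, Finset.sum_const_zero, zero_add, ite_mul]
    refine (Nat.cast_sum _ _).trans ?_
    have hterm : ∀ g : A.FormGate k, ((if g.node = u then (g.weight.val + m) *
        ((A.circuit hk e).eval x (Sum.inr g)).toNat else 0 : ℕ) : ZMod m) =
        if g.node = u then ((m / g.1.1 : ℕ) : ZMod m) * ((formCoeff (g.1.1 ^ A.exponent g.1)
          (A.inverse g.1) g.supp.card g.bit : ℤ) *
          (if ∑ v ∈ g.supp, g.form v * ((y v).toNat : ZMod (A.modulus g.1)) =
            (g.bit.toNat : ZMod (A.modulus g.1)) then 1 else 0)) else 0 := by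
      intro g
      rw [A.eval_formGate hk e x g, apply_ite (Nat.cast : ℕ → ZMod m), Nat.cast_zero, Nat.cast_mul,
        Nat.cast_add, ZMod.natCast_self, add_zero, ZMod.natCast_val, ZMod.cast_id, ← mul_assoc]
      congr 2
      by_cases hc : ∑ v ∈ g.supp, g.form v * ((y v).toNat : ZMod (A.modulus g.1)) =
        (g.bit.toNat : ZMod (A.modulus g.1))
      · rw [decide_eq_true hc, if_pos hc, Bool.toNat_true, Nat.cast_one]
      · rw [decide_eq_false hc, if_neg hc, Bool.toNat_false, Nat.cast_zero]
    refine (Finset.sum_congr rfl fun g _ => hterm g).trans ?_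
    rw [A.sum_formGate u (fun p S a t => ((m / p.1 : ℕ) : ZMod m) * ((formCoeff (p.1 ^ A.exponent p)
          (A.inverse p) S.card t : ℤ) * (if ∑ v ∈ S, a v * ((y v).toNat : ZMod (A.modulus p)) =
            (t.toNat : ZMod (A.modulus p)) then 1 else 0)))]
    push_cast
    simp only [Finset.mul_sum]
  refine (Iff.of_eq (congrArg (· = _) key)).trans ?_
  rw [sum_div_mul_eq_zero_iff A.ne_zero]
  refine forall_congr' fun p => ?_
  rw [dvd_sum_formCoeff_iff (Nat.prime_of_mem_primeFactors p.2) (A.inverse_mul p.1 p.2)]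

/-- The number of false children of a node is divisible by coprime prime powers whose product
exceeds it, so it is zero. Hence every inner node computes the conjunction of its children. -/
theorem computesAnd_circuit (hk : ∀ i, 0 < k i) (e : TreeLeaf k ≃ Fin n)
    (hK : maxBlock k < ∏ p ∈ m.primeFactors, p ^ A.exponent p) :
    (A.circuit hk e).ComputesAnd := by
  classical
  intro x
  have hnode : ∀ u : TreeNode k, u.level ≠ 0 → ((A.circuit hk e).eval x (Sum.inl u) = true ↔
      ∀ v, u.HasChild v → (A.circuit hk e).eval x (Sum.inl v) = true) := by
    intro u hu
    rw [A.eval_node hk e x hu]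
    constructor
    · intro hdvd
      have h1 := Finset.prod_dvd_of_isRelPrime (s := fun p => p ^ A.exponent p)
        (I := ℕ) (t := m.primeFactors) (fun p hp p' hp' hne => Nat.coprime_iff_isRelPrime.1
          (Nat.Coprime.pow _ _ ((Nat.coprime_primes (Nat.prime_of_mem_primeFactors hp)
            (Nat.prime_of_mem_primeFactors hp')).2 hne))) fun p hp => hdvd ⟨p, hp⟩
      have h2 := Nat.eq_zero_of_dvd_of_lt h1 (((Finset.card_filter_le _ _).trans
        (TreeNode.card_children_le u)).trans_lt hK)
      intro v hv
      by_contra hc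
      rw [Finset.card_eq_zero] at h2
      refine Finset.notMem_empty v (h2 ▸ ?_)
      simp [hv, hc]
    · intro hv p
      rw [Finset.card_eq_zero.2]
      · exact dvd_zero _
      · ext v
        simp only [Finset.mem_filter, Finset.mem_univ, true_and, Finset.notMem_empty, iff_false]
        rintro ⟨h1, h2⟩
        rw [hv v h1] at h2
        cases h2
  constructor
  · intro hroot
    have hall : ∀ j (v : TreeNode k), v.level + j = h →
        (A.circuit hk e).eval x (Sum.inl v) = true := by
      intro j
      induction j with
      | zero =>
        intro v hv
        rw [TreeNode.eq_top_of_level (by omega : v.level = h)]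
        exact hroot
      | succ j ih =>
        intro v hv
        obtain ⟨u, hu⟩ := TreeNode.exists_hasChild_of_lt (by omega : v.level < h)
        have hl := hu.level_eq
        exact (hnode u (by omega)).1 (ih u (by omega)) v hu
    intro i
    rw [← (A.circuit hk e).eval_of_label_inl x ((A.label_eq_inl_iff e _ i).2 rfl)]
    exact hall h _ (by rw [(e.symm i).2, zero_add])
  · intro hx
    have hall : ∀ j (v : TreeNode k), v.level = j →
        (A.circuit hk e).eval x (Sum.inl v) = true := by
      intro j
      induction j with
      | zero =>
        intro v hv
        rw [(A.circuit hk e).eval_of_label_inl x (g := Sum.inl v) (A.label_inl_of_eq e hv), hx]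
      | succ j ih =>
        intro v hv
        refine (hnode v (by omega)).2 fun w hw => ih w ?_
        have := hw.level_eq
        omega
    exact hall h _ rfl

end AndParams

/-! ### The size of the circuit and the choice of parameters -/

namespace AndParams

variable {m n h : ℕ} (A : AndParams m) {k : Fin h → ℕ}

theorem modulus_le (p : ℕ) : A.modulus p ≤ m :=
  Nat.le_of_dvd (Nat.pos_of_ne_zero A.ne_zero) (A.modulus_dvd p)

namespace FormGate

variable {A} (g : A.FormGate k)

/-- The graph of the linear form of a gate on its support. -/
noncomputable def graph : Finset (TreeNode k × Fin (m + 1)) :=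
  g.supp.map ⟨fun v => (v, ⟨(g.form v).val, ((ZMod.val_lt _).trans_le (A.modulus_le _)).trans
    (Nat.lt_succ_self m)⟩), fun _ _ h => (Prod.mk.inj h).1⟩

theorem exists_range_eq_graph {d : ℕ} (hd : ∀ p ∈ m.primeFactors, p ^ A.exponent p ≤ d) :
    ∃ f : Fin d → TreeNode k × Fin (m + 1), Set.range f = g.graph := by
  have hcard : g.graph.card ≤ d :=
    (Finset.card_map _).trans_le (g.2.2.2.2.1.le.trans (hd _ g.1.2))
  have hne : Nonempty g.graph := (Finset.Nonempty.map g.2.2.2.1).to_subtype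
  obtain ⟨ι⟩ : Nonempty (g.graph ↪ Fin d) :=
    Function.Embedding.nonempty_of_card_le (by simpa using hcard)
  refine ⟨fun i => (Function.invFun ι i).1, ?_⟩
  rw [Set.range_comp' Subtype.val, (Function.invFun_surjective ι.injective).range_eq, Set.image_univ,
    Subtype.range_coe_subtype]
  rfl

theorem eq_of_graph_eq {g g' : A.FormGate k} (hp : g.1 = g'.1) (hu : g.node = g'.node)
    (ht : g.bit = g'.bit) (hg : g.graph = g'.graph) : g = g' := by
  obtain ⟨p, ⟨u, S, a, t⟩, hx⟩ := g
  obtain ⟨p', ⟨u', S', a', t'⟩, hx'⟩ := g'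
  obtain rfl : p = p' := hp
  obtain rfl : u = u' := hu
  obtain rfl : t = t' := ht
  have hmem : ∀ v z, (v, z) ∈ (FormGate.graph ⟨p, ⟨u, S, a, t⟩, hx⟩ : Finset (TreeNode k × Fin (m + 1))) ↔
      v ∈ S ∧ (a v).val = z := by
    intro v z
    simp [graph, supp, form, Fin.ext_iff]
  have hmem' : ∀ v z, (v, z) ∈ (FormGate.graph ⟨p, ⟨u, S', a', t⟩, hx'⟩ : Finset (TreeNode k × Fin (m + 1))) ↔
      v ∈ S' ∧ (a' v).val = z := by
    intro v z
    simp [graph, supp, form, Fin.ext_iff]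
  have hiff : ∀ v, ∀ z : Fin (m + 1), v ∈ S ∧ (a v).val = z ↔ v ∈ S' ∧ (a' v).val = z :=
    fun v z => by rw [← hmem, ← hmem', hg]
  have hlt : ∀ z : ZMod (A.modulus p), z.val < m + 1 := fun z =>
    ((ZMod.val_lt z).trans_le (A.modulus_le _)).trans (Nat.lt_succ_self m)
  have hS : S = S' := by
    ext v
    exact ⟨fun hv => ((hiff v ⟨_, hlt (a v)⟩).1 ⟨hv, rfl⟩).1,
      fun hv => ((hiff v ⟨_, hlt (a' v)⟩).2 ⟨hv, rfl⟩).1⟩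
  subst hS
  have ha : a = a' := by
    funext v
    by_cases hv : v ∈ S
    · exact ZMod.val_injective _ ((hiff v ⟨_, hlt (a' v)⟩).2 ⟨hv, rfl⟩).2
    · exact (hx.2.2.2 v hv).trans (hx'.2.2.2 v hv).symm
  subst ha
  rfl

end FormGate

/-- A gate is determined by its prime, node, bit and the graph of its form. The graph has at most
`d` points, so it is the range of a function on `Fin d`. -/
theorem card_formGate_le {d : ℕ} (hd : ∀ p ∈ m.primeFactors, p ^ A.exponent p ≤ d) :
    Fintype.card (A.FormGate k) ≤ (m + 1) * (Fintype.card (TreeNode k) * (2 *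
      (Fintype.card (TreeNode k) * (m + 1)) ^ d)) := by
  choose f hf using fun g : A.FormGate k => g.exists_range_eq_graph hd
  have hinj : Function.Injective (fun g : A.FormGate k =>
      ((⟨g.1.1, Nat.lt_succ_of_le (Nat.le_of_mem_primeFactors g.1.2)⟩, g.node, g.bit, f g) :
        Fin (m + 1) × TreeNode k × Bool × (Fin d → TreeNode k × Fin (m + 1)))) := by
    intro g g' hgg
    simp only [Prod.mk.injEq, Fin.mk.injEq] at hgg
    refine FormGate.eq_of_graph_eq (Subtype.ext hgg.1) hgg.2.1 hgg.2.2.1 ?_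
    rw [← Finset.coe_inj, ← hf, ← hf, hgg.2.2.2]
  simpa using Fintype.card_le_of_injective _ hinj

theorem wires_le (g g' : TreeNode k ⊕ A.FormGate k) : A.wires k g g' ≤ 2 * m := by
  have : NeZero m := ⟨A.ne_zero⟩
  rcases g with v | g <;> rcases g' with u | g' <;> simp only [wires]
  · omega
  · have h1 := A.modulus_le g'.1
    have h2 := ZMod.val_lt (g'.form v)
    split_ifs <;> omega
  · have h1 := ZMod.val_lt g.weight
    split_ifs <;> omega
  · omega

theorem size_circuit_le (hk : ∀ i, 0 < k i) (e : TreeLeaf k ≃ Fin n) {d K : ℕ} (hd1 : 1 ≤ d)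
    (hd : ∀ p ∈ m.primeFactors, p ^ A.exponent p ≤ d) (hK : maxBlock k ≤ K) (hh : h + 1 ≤ K)
    (hm : m + 1 ≤ K) : (A.circuit hk e).size ≤ K ^ ((8 * h + 18) * d) := by
  have hm1 := Nat.pos_of_ne_zero A.ne_zero
  have hK2 : 2 ≤ K := by omega
  set T := Fintype.card (TreeNode k)
  have hT : T ≤ K ^ (2 * h + 1) := by
    calc T ≤ (h + 1) * (maxBlock k + 1) ^ h := TreeNode.card_le
      _ ≤ K * (K ^ 2) ^ h := by
          gcongr
          nlinarith
      _ = K ^ (2 * h + 1) := by rw [← pow_mul, pow_succ']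
  have hF : Fintype.card (A.FormGate k) ≤ K ^ (2 * h + 3 + (2 * h + 2) * d) := by
    calc Fintype.card (A.FormGate k) ≤ (m + 1) * (T * (2 * (T * (m + 1)) ^ d)) := A.card_formGate_le hd
      _ ≤ K * (K ^ (2 * h + 1) * (K * (K ^ (2 * h + 1) * K) ^ d)) := by gcongr
      _ = K ^ (2 * h + 3 + (2 * h + 2) * d) := by rw [← pow_succ, ← pow_mul]; ring
  have hG : Fintype.card (A.circuit hk e).Gate ≤ K ^ (2 * h + 4 + (2 * h + 2) * d) := by
    calc Fintype.card (TreeNode k ⊕ A.FormGate k) = T + Fintype.card (A.FormGate k) := Fintype.card_sum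
      _ ≤ K ^ (2 * h + 3 + (2 * h + 2) * d) + K ^ (2 * h + 3 + (2 * h + 2) * d) := by
          refine Nat.add_le_add (hT.trans (Nat.pow_le_pow_right (by omega) (by omega))) hF
      _ = 2 * K ^ (2 * h + 3 + (2 * h + 2) * d) := (two_mul _).symm
      _ ≤ K * K ^ (2 * h + 3 + (2 * h + 2) * d) := Nat.mul_le_mul_right _ hK2
      _ = K ^ (2 * h + 4 + (2 * h + 2) * d) := by ring
  set G := Fintype.card (A.circuit hk e).Gate
  have hsize : (A.circuit hk e).size ≤ G + G * (G * (2 * m)) := by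
    refine Nat.add_le_add_left ?_ _
    refine (Finset.sum_le_card_nsmul _ _ (G * (2 * m)) fun g _ => ?_).trans_eq ?_
    · refine (Finset.sum_le_card_nsmul _ _ (2 * m) fun g' _ => A.wires_le g g').trans_eq ?_
      rfl
    · rfl
  calc (A.circuit hk e).size ≤ G + G * (G * (2 * m)) := hsize
    _ ≤ G ^ 2 * (2 * m + 1) := by nlinarith [Nat.le_self_pow (two_ne_zero) G]
    _ ≤ (K ^ (2 * h + 4 + (2 * h + 2) * d)) ^ 2 * K ^ 2 := by
        gcongr
        nlinarith
    _ = K ^ (4 * h + 10 + (4 * h + 4) * d) := by rw [← pow_mul]; ring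
    _ ≤ K ^ ((8 * h + 18) * d) := Nat.pow_le_pow_right (by omega) (by nlinarith)

theorem exists_params {m : ℕ} (hr : 2 ≤ m.primeFactors.card) {D : ℕ} (hD : 2 ≤ D) :
    ∃ A : AndParams m, D ^ m.primeFactors.card ≤ ∏ p ∈ m.primeFactors, p ^ A.exponent p ∧
      ∀ p ∈ m.primeFactors, p ^ A.exponent p ≤ m ^ 2 * D := by
  have hq : ∀ p, ∃ q ∈ m.primeFactors, q ≠ p := fun p => by
    obtain ⟨q, hq, hne⟩ := Finset.exists_mem_ne (by omega : 1 < m.primeFactors.card) p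
    exact ⟨q, hq, hne⟩
  choose q hq hqp using hq
  have hu : ∀ p, ∃ u, p ∈ m.primeFactors → u * q p ≡ 1 [MOD p] := fun p => by
    by_cases hp : p ∈ m.primeFactors
    · have hpp := Nat.prime_of_mem_primeFactors hp
      obtain ⟨u, -, hu⟩ := Nat.exists_mul_mod_eq_one_of_coprime
        ((Nat.coprime_primes (Nat.prime_of_mem_primeFactors (hq p)) hpp).2 (hqp p)) hpp.one_lt
      refine ⟨u, fun _ => ?_⟩
      rw [Nat.ModEq, mul_comm, hu, Nat.mod_eq_of_lt hpp.one_lt]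
    · exact ⟨0, fun h => absurd h hp⟩
  choose u hu using hu
  have hm : m ≠ 0 := by rintro rfl; simp at hr
  -- The extra `1` makes the exponent nonzero for every index, prime or not; it costs one of the two
  -- factors `m` in the bound `m ^ 2 * D`.
  refine ⟨⟨q, fun p => Nat.clog p D + 1, u, fun p => Nat.prime_of_mem_primeFactors (hq p),
    fun p => Nat.dvd_of_mem_primeFactors (hq p), hu, fun p => Nat.succ_ne_zero _, hm⟩, ?_, ?_⟩
  · rw [← Finset.prod_const]
    refine Finset.prod_le_prod' fun p hp => ?_
    have hpp := Nat.prime_of_mem_primeFactors hp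
    exact (Nat.le_pow_clog hpp.one_lt D).trans (Nat.pow_le_pow_right hpp.pos (Nat.le_succ _))
  · intro p hp
    have hpp := Nat.prime_of_mem_primeFactors hp
    have h1 := Nat.pow_pred_clog_lt_self hpp.one_lt (x := D) (by omega)
    have h2 : 0 < Nat.clog p D := Nat.clog_pos hpp.one_lt hD
    have h3 : p ^ (Nat.clog p D + 1) = p ^ (Nat.clog p D).pred * p ^ 2 := by
      rw [← pow_add]
      congr 1
      rw [Nat.pred_eq_sub_one]
      omega
    change p ^ (Nat.clog p D + 1) ≤ _
    rw [h3, mul_comm]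
    exact Nat.mul_le_mul (Nat.pow_le_pow_left (Nat.le_of_mem_primeFactors hp) 2) h1.le

end AndParams

theorem exists_symmetric_and_circuit {m n h : ℕ} {k : Fin h → ℕ} (hk : ∀ i, 0 < k i)
    (e : TreeLeaf k ≃ Fin n) (hr : 2 ≤ m.primeFactors.card) (hh : h + 1 ≤ maxBlock k)
    (hm : m + 1 ≤ maxBlock k) :
    ∃ C : ModCircuit m n, C.IsSymmetric (treeAut k e) ∧ C.ComputesAnd ∧ C.RootIsOnlySink ∧
      C.depth = 2 * h ∧ (C.size : ℝ) ≤ (2 : ℝ) ^ ((16 * h + 36) * m ^ 2 *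
        ((maxBlock k : ℝ) ^ (1 / (m.primeFactors.card : ℝ)) * Real.logb 2 (maxBlock k)) : ℝ) := by
  set K := maxBlock k
  set r := m.primeFactors.card
  have hK0 : (1 : ℝ) ≤ K := by exact_mod_cast (by omega : 1 ≤ K)
  have hr0 : (0 : ℝ) < r := by exact_mod_cast (by omega : 0 < r)
  set X : ℝ := (K : ℝ) ^ (1 / (r : ℝ)) with hX
  have hX1 : 1 ≤ X := Real.one_le_rpow hK0 (by positivity)
  have hXr : X ^ r = K := by
    rw [hX, ← Real.rpow_natCast, ← Real.rpow_mul (by linarith), one_div_mul_cancel hr0.ne',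
      Real.rpow_one]
  have hfl : 1 ≤ ⌊X⌋₊ := Nat.le_floor (by exact_mod_cast hX1)
  have hfle := Nat.floor_le (by linarith : 0 ≤ X)
  have hflt := Nat.lt_floor_add_one X
  -- This `D` is the least integer with `D ^ r > K`.
  obtain ⟨A, hA1, hA2⟩ := AndParams.exists_params hr (D := ⌊X⌋₊ + 1) (by omega)
  have hKD : K < (⌊X⌋₊ + 1) ^ r := by
    have : (K : ℝ) < ((⌊X⌋₊ + 1 : ℕ) : ℝ) ^ r := by
      rw [← hXr]
      push_cast
      exact pow_lt_pow_left₀ hflt (by linarith) (by omega)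
    exact_mod_cast this
  have hm0 : 0 < m := Nat.pos_of_ne_zero A.ne_zero
  refine ⟨A.circuit hk e, A.isSymmetric_circuit hk e, A.computesAnd_circuit hk e (hKD.trans_le hA1),
    A.rootIsOnlySink_circuit hk e, A.depth_circuit hk e, ?_⟩
  have hsize := A.size_circuit_le hk e (d := m ^ 2 * (⌊X⌋₊ + 1)) (K := K)
    (Nat.mul_pos (by positivity) (by omega)) hA2 le_rfl hh hm
  calc ((A.circuit hk e).size : ℝ) ≤ (K : ℝ) ^ ((8 * h + 18) * (m ^ 2 * (⌊X⌋₊ + 1))) := by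
        exact_mod_cast hsize
    _ = (K : ℝ) ^ (((8 * h + 18) * (m ^ 2 * (⌊X⌋₊ + 1)) : ℕ) : ℝ) := (Real.rpow_natCast _ _).symm
    _ ≤ (K : ℝ) ^ ((16 * h + 36) * m ^ 2 * X) := by
        refine Real.rpow_le_rpow_of_exponent_le hK0 ?_
        push_cast
        have h1 : (⌊X⌋₊ : ℝ) + 1 ≤ 2 * X := by linarith
        calc ((8 * h + 18) * (m ^ 2 * ((⌊X⌋₊ : ℝ) + 1)) : ℝ) ≤ (8 * h + 18) * (m ^ 2 * (2 * X)) := by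
              gcongr
          _ = _ := by ring
    _ = (2 : ℝ) ^ ((16 * h + 36) * m ^ 2 * (X * Real.logb 2 K) : ℝ) := by
        have hK1 : (K : ℝ) = (2 : ℝ) ^ Real.logb 2 K := by
          rw [Real.rpow_logb (by norm_num) (by norm_num) (by linarith)]
        conv_lhs => rw [hK1]
        rw [← Real.rpow_mul (by norm_num)]
        congr 1
        ring

/-! ### Both bounds for large `n` -/

theorem theorem2 (m r h : ℕ) (hm : m.primeFactors.card = r) (hr : 2 ≤ r) :
    ∃ c : ℝ, 0 < c ∧ ∃ c' : ℝ, 0 < c' ∧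
      ∀ (N : Set ℕ) (k : ℕ → Fin h → ℕ), (∀ n ∈ N, ∏ i, k n i = n) →
        (∀ᶠ n in atTop, n ∈ N → ∀ i, 8 < k n i) →
        ∀ᶠ n in atTop, n ∈ N → ∀ e : TreeLeaf (k n) ≃ Fin n,
          (∀ C : ModCircuit m n, C.IsSymmetric (treeAut (k n) e) → C.ComputesAnd →
            (2 : ℝ) ^ (c * ((maxBlock (k n) : ℝ) ^ (1 / (r : ℝ)) * Real.logb 2 (maxBlock (k n)))) ≤ C.size) ∧
          ∃ C : ModCircuit m n, C.IsSymmetric (treeAut (k n) e) ∧ C.ComputesAnd ∧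
            C.RootIsOnlySink ∧ C.depth = 2 * h ∧
            (C.size : ℝ) ≤
              (2 : ℝ) ^ (c' * ((maxBlock (k n) : ℝ) ^ (1 / (r : ℝ)) * Real.logb 2 (maxBlock (k n)))) := by
  subst hm
  have hm0 : 0 < m := Nat.pos_of_ne_zero (by rintro rfl; simp at hr)
  have hm0' : (0 : ℝ) < m := by exact_mod_cast hm0
  have hr0 : (0 : ℝ) < m.primeFactors.card := by exact_mod_cast (by omega : 0 < m.primeFactors.card)
  refine ⟨1 / (64 * m * m.primeFactors.card), by positivity, (16 * h + 36) * m ^ 2, by positivity, ?_⟩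
  intro N k hN hk8
  -- As `n` is at most the `h`-th power of the largest block size, `n > K₀ ^ h` makes that block
  -- size large enough for both bounds.
  let K₀ := ((32 * m) ^ 2) ^ m.primeFactors.card + h + m + 1
  filter_upwards [hk8, eventually_gt_atTop (K₀ ^ h)] with n hn8 hnK hnN e
  have hk : ∀ i, 0 < k n i := fun i => (Nat.zero_lt_succ 7).trans (hn8 hnN i)
  have hprod := hN n hnN
  have hK : K₀ ≤ maxBlock (k n) := by
    by_contra hlt
    have : n ≤ K₀ ^ h := by
      rw [← hprod]
      refine (Finset.prod_le_pow_card _ _ K₀ fun i _ =>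
        (TreeNode.le_maxBlock _ i).trans (not_le.1 hlt).le).trans_eq ?_
      rw [Finset.card_univ, Fintype.card_fin]
    omega
  refine ⟨fun C hsymm hC => ?_, exists_symmetric_and_circuit hk e hr (by omega) (by omega)⟩
  -- For `h = 0` the empty product gives `n = 1`, which `n > K₀ ^ 0` excludes.
  have hh : h ≠ 0 := by
    rintro rfl
    rw [Finset.univ_eq_empty, Finset.prod_empty] at hprod
    rw [pow_zero] at hnK
    omega
  have : Nonempty (Fin h) := ⟨⟨0, Nat.pos_of_ne_zero hh⟩⟩
  obtain ⟨i₀, -, hi₀⟩ := Finset.exists_mem_eq_sup Finset.univ Finset.univ_nonempty (k n)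
  change maxBlock (k n) = k n i₀ at hi₀
  obtain ⟨v, hv1, hv2, hv3⟩ := exists_two_rpow_le_factorial (m := m) (r := m.primeFactors.card)
    (K := maxBlock (k n)) hm0 (by omega) (by omega)
  refine hv3.trans ?_
  exact_mod_cast factorial_le_size hk e hr hsymm hC hv1 i₀ (hi₀ ▸ hv2)
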